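/- Let $\psi:\mathbb{R}\to\mathbb{R}$ be increasing and differentiable with $\psi'(t)\neq 0$ for all $t$ and $\psi(t)\to\pm\infty$ as $t\to\pm\infty$. Let $L^2_\psi(\mathbb{R})$ be the space of measurable $v:\mathbb{R}\to\mathbb{R}$ with $\|v\|_{L^2_\psi}^2=\int_{\mathbb{R}}|v|^2\psi'\,dt<\infty$, with scalar product $(v,w)_\psi=\int_{\mathbb{R}} v\,w\,\psi'\,dt$, and put $\tilde v=v\circ\psi^{-1}$ and $\mathcal F(f)(\xi)=\int_{\mathbb{R}} f(s)e^{-i\xi s}\,ds$ (extended to $L^2(\mathbb{R})$). For $\delta>0$ let $n$ be the integer with $n-1\le\delta<n$. For test functions $w=\varphi\circ\psi$, $\varphi\in C_0^\infty(\mathbb{R})$, let $$D^{\delta,\psi}_t w(t)=\Big(\tfrac{1}{\psi'(t)}\tfrac{d}{dt}\Big)^n\frac{1}{\Gamma(n-\delta)}\int_{-\infty}^t\psi'(z)(\psi(t)-\psi(z))^{n-\delta-1}w(z)\,dz,$$ $${}_tD^{\delta,\psi} w(t)=\Big(-\tfrac{1}{\psi'(t)}\tfrac{d}{dt}\Big)^n\frac{1}{\Gamma(n-\delta)}\int_t^{\infty}\psi'(z)(\psi(z)-\psi(t))^{n-\delta-1}w(z)\,dz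 .$$ For $v\in L^2_\psi(\mathbb{R})$ the derivatives are understood in the distribution sense: $D^{\delta,\psi}_tv\in L^2_\psi(\mathbb{R})$ means that there is $g\in L^2_\psi(\mathbb{R})$ with $(g,w)_\psi=(v,{}_tD^{\delta,\psi}w)_\psi$ for all test functions $w$, and then $D^{\delta,\psi}_tv=g$; likewise ${}_tD^{\delta,\psi}v=h$ if $h\in L^2_\psi(\mathbb{R})$ and $(h,w)_\psi=(v,D_t^{\delta,\psi}w)_\psi$ for all test functions $w$. Define the semi-norms $$|v|_L=\|D^{\delta,\psi}_tv\|_{L^2_\psi},\qquad |v|_R=\|{}_tD^{\delta,\psi}v\|_{L^2_\psi},\qquad |v|_c=\big|(D^{\delta,\psi}_tv,\,{}_tD^{\delta,\psi}v)_\psi\big|^{1/2},\qquad |v|_H=\big\||\xi|^\delta\mathcal F(\tilde v)\big\|_{L^2(\mathbb{R})},$$ and the norms $\|v\|_X=(\|v\|_{L^2_\psi}^2+|v|_X^2)^{1/2}$ for $X\in\{L,R,c,H\}$. Let ${}^{L}H^{\delta,\psi}(\mathbb{R})$, ${}^{R}H^{\delta,\psi}(\mathbb{R})$ and ${}^{c}H^{\delta,\psi}(\mathbb{R})$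 be the sets of $v\in L^2_\psi(\mathbb{R})$ for which, respectively, the left derivative, the right derivative, and both derivatives lie in $L^2_\psi(\mathbb{R})$, and let $H^{\delta,\psi}(\mathbb{R})$ be the set of $v\in L^2_\psi(\mathbb{R})$ with $(1+|\xi|^\delta)\mathcal F(\tilde v)\in L^2(\mathbb{R})$. Let $\delta>0$ with $\delta\ne n-1/2$ for all $n\in\mathbb{N}$. Then, for every such $\psi$, the spaces ${}^{L}H^{\delta,\psi}(\mathbb{R})$, ${}^{R}H^{\delta,\psi}(\mathbb{R})$, ${}^{c}H^{\delta,\psi}(\mathbb{R})$ and $H^{\delta,\psi}(\mathbb{R})$ are equal, with equivalent semi-norms and norms: there are constants $c,C>0$ depending only on $\delta$ such that $c\,|v|_H\le|v|_X\le C\,|v|_H$ and $c\,\|v\|_H\le\|v\|_X\le C\,\|v\|_H$ for all $X\in\{L,R,c\}$ and all $v$ in this space. -/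

import Mathlib

open MeasureTheory Set Filter FourierTransform
open scoped ContDiff

noncomputable section

namespace PsiFrac

/-- Admissible scaling functions on the whole line: increasing, differentiable, with nowhere
vanishing derivative, and tending to `±∞` at `±∞` (so that `ψ⁻¹` is defined on all of `ℝ`). -/
structure IsScaling (ψ : ℝ → ℝ) : Prop where
  strictMono : StrictMono ψ
  differentiable : Differentiable ℝ ψ
  deriv_ne_zero : ∀ t, deriv ψ t ≠ 0
  tendsto_atTop : Tendsto ψ atTop atTop
  tendsto_atBot : Tendsto ψ atBot atBot

/-- The function `ṽ = v ∘ ψ⁻¹`. -/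
def pull (ψ v : ℝ → ℝ) : ℝ → ℝ := fun s => v (Function.invFun ψ s)

/-! ### The weighted space `L²_ψ(ℝ)` of real-valued functions -/

/-- `v ∈ L²_ψ(ℝ)`: `v` is (Lebesgue) measurable and `∫ |v|² ψ' dt < ∞`. -/
def MemL2 (ψ v : ℝ → ℝ) : Prop :=
  AEStronglyMeasurable v volume ∧ Integrable (fun t => |v t| ^ 2 * deriv ψ t) volume

/-- The scalar product `(v, w) = ∫ v w ψ' dt` of `L²_ψ(ℝ)`. -/
def inner2 (ψ v w : ℝ → ℝ) : ℝ := ∫ t, v t * w t * deriv ψ t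

/-- The norm of `L²_ψ(ℝ)`. -/
def norm2 (ψ v : ℝ → ℝ) : ℝ := Real.sqrt (inner2 ψ v v)

/-! ### `ψ`-Riemann–Liouville operators on the whole line -/

/-- Left `ψ`-fractional integral of order `α`, with lower limit `-∞`. -/
def leftInt (ψ : ℝ → ℝ) (α : ℝ) (v : ℝ → ℝ) : ℝ → ℝ := fun t =>
  1 / Real.Gamma α * ∫ z in Iio t, deriv ψ z * (ψ t - ψ z) ^ (α - 1) * v z

/-- Right `ψ`-fractional integral of order `α`, with upper limit `+∞`. -/
def rightInt (ψ : ℝ → ℝ) (α : ℝ) (v : ℝ → ℝ) : ℝ → ℝ := fun t =>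
  1 / Real.Gamma α * ∫ z in Ioi t, deriv ψ z * (ψ z - ψ t) ^ (α - 1) * v z

/-- The operator `(1/ψ') d/dt`. -/
def scaledDeriv (ψ f : ℝ → ℝ) : ℝ → ℝ := fun t => 1 / deriv ψ t * deriv f t

/-- The integer `n ≥ 1` with `n - 1 ≤ δ < n` (for `δ ≥ 0`). -/
def order (δ : ℝ) : ℕ := ⌊δ⌋₊ + 1

/-- Left `ψ`-Riemann–Liouville derivative `((1/ψ') d/dt)ⁿ I^{n-δ}` (pointwise definition). -/
def leftRL (ψ : ℝ → ℝ) (δ : ℝ) (v : ℝ → ℝ) : ℝ → ℝ :=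
  (scaledDeriv ψ)^[order δ] (leftInt ψ (order δ - δ) v)

/-- Right `ψ`-Riemann–Liouville derivative `(-(1/ψ') d/dt)ⁿ I^{n-δ}` (pointwise definition). -/
def rightRL (ψ : ℝ → ℝ) (δ : ℝ) (v : ℝ → ℝ) : ℝ → ℝ :=
  (fun f t => -scaledDeriv ψ f t)^[order δ] (rightInt ψ (order δ - δ) v)

/-! ### Fractional derivatives of `L²_ψ` functions, in the distribution sense -/

/-- Test functions: `w = φ ∘ ψ` with `φ ∈ C₀^∞(ℝ)`, i.e. compactly supported functions that are
infinitely differentiable for `(1/ψ') d/dt`. For smooth `ψ` these are exactly the functions in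
`C₀^∞(ℝ)`; for a `ψ` that is only differentiable they are the class on which the pointwise
fractional derivatives of every order exist. -/
def IsTest (ψ w : ℝ → ℝ) : Prop :=
  ContDiff ℝ ∞ (pull ψ w) ∧ HasCompactSupport (pull ψ w)

/-- `g ∈ L²_ψ(ℝ)` is the left `ψ`-fractional derivative of order `δ` of `v`:
`(g, w) = (v, ₜD w)` for all test functions `w`. -/
def IsLeftDeriv (ψ : ℝ → ℝ) (δ : ℝ) (v g : ℝ → ℝ) : Prop :=
  MemL2 ψ g ∧ ∀ w, IsTest ψ w → inner2 ψ g w = inner2 ψ v (rightRL ψ δ w)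

/-- `g ∈ L²_ψ(ℝ)` is the right `ψ`-fractional derivative of order `δ` of `v`:
`(g, w) = (v, D w)` for all test functions `w`. -/
def IsRightDeriv (ψ : ℝ → ℝ) (δ : ℝ) (v g : ℝ → ℝ) : Prop :=
  MemL2 ψ g ∧ ∀ w, IsTest ψ w → inner2 ψ g w = inner2 ψ v (leftRL ψ δ w)

open Classical in
/-- The left `ψ`-fractional derivative (unique up to null sets; `0` if there is none in
`L²_ψ(ℝ)`). -/
def leftD (ψ : ℝ → ℝ) (δ : ℝ) (v : ℝ → ℝ) : ℝ → ℝ :=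
  if h : ∃ g, IsLeftDeriv ψ δ v g then h.choose else 0

open Classical in
/-- The right `ψ`-fractional derivative (unique up to null sets; `0` if there is none in
`L²_ψ(ℝ)`). -/
def rightD (ψ : ℝ → ℝ) (δ : ℝ) (v : ℝ → ℝ) : ℝ → ℝ :=
  if h : ∃ g, IsRightDeriv ψ δ v g then h.choose else 0

/-! ### The left, right and mixed spaces -/

/-- The left space: `v ∈ L²_ψ(ℝ)` whose left derivative belongs to `L²_ψ(ℝ)`. -/
def leftSpace (ψ : ℝ → ℝ) (δ : ℝ) : Set (ℝ → ℝ) :=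
  {v | MemL2 ψ v ∧ ∃ g, IsLeftDeriv ψ δ v g}

def leftSemi (ψ : ℝ → ℝ) (δ : ℝ) (v : ℝ → ℝ) : ℝ := norm2 ψ (leftD ψ δ v)

def leftNorm (ψ : ℝ → ℝ) (δ : ℝ) (v : ℝ → ℝ) : ℝ :=
  Real.sqrt (norm2 ψ v ^ 2 + leftSemi ψ δ v ^ 2)

/-- The right space: `v ∈ L²_ψ(ℝ)` whose right derivative belongs to `L²_ψ(ℝ)`. -/
def rightSpace (ψ : ℝ → ℝ) (δ : ℝ) : Set (ℝ → ℝ) :=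
  {v | MemL2 ψ v ∧ ∃ g, IsRightDeriv ψ δ v g}

def rightSemi (ψ : ℝ → ℝ) (δ : ℝ) (v : ℝ → ℝ) : ℝ := norm2 ψ (rightD ψ δ v)

def rightNorm (ψ : ℝ → ℝ) (δ : ℝ) (v : ℝ → ℝ) : ℝ :=
  Real.sqrt (norm2 ψ v ^ 2 + rightSemi ψ δ v ^ 2)

/-- The mixed space: `v ∈ L²_ψ(ℝ)` for which the `L²_ψ(ℝ)` scalar product of the left and the right
derivative is defined, i.e. both derivatives are elements of `L²_ψ(ℝ)`. -/
def mixedSpace (ψ : ℝ → ℝ) (δ : ℝ) : Set (ℝ → ℝ) :=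
  {v | MemL2 ψ v ∧ (∃ g, IsLeftDeriv ψ δ v g) ∧ ∃ h, IsRightDeriv ψ δ v h}

def mixedSemi (ψ : ℝ → ℝ) (δ : ℝ) (v : ℝ → ℝ) : ℝ :=
  Real.sqrt |inner2 ψ (leftD ψ δ v) (rightD ψ δ v)|

def mixedNorm (ψ : ℝ → ℝ) (δ : ℝ) (v : ℝ → ℝ) : ℝ :=
  Real.sqrt (norm2 ψ v ^ 2 + mixedSemi ψ δ v ^ 2)

/-! ### The Fourier-defined space -/

open Classical in
/-- The `L²` Fourier transform in the convention `∫ f(s) e^{-iξs} ds`: Mathlib's transform, whose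
kernel is `e^{-2πiξs}`, evaluated at `ξ / (2π)`. -/
def fourierL2 (f : ℝ → ℂ) : ℝ → ℂ := fun ξ =>
  if h : MemLp f 2 volume then (𝓕 (h.toLp f) : Lp ℂ 2 (volume : Measure ℝ)) (ξ / (2 * Real.pi))
  else 0

/-- `𝓕(ṽ)`. -/
def fourierPull (ψ v : ℝ → ℝ) : ℝ → ℂ := fourierL2 (fun s => (pull ψ v s : ℂ))

/-- `H^{δ,ψ}(ℝ)`: `v ∈ L²_ψ(ℝ)` with `(1 + |ξ|^δ) 𝓕(ṽ)(ξ) ∈ L²(ℝ)`. -/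
def fourierSpace (ψ : ℝ → ℝ) (δ : ℝ) : Set (ℝ → ℝ) :=
  {v | MemL2 ψ v ∧ MemLp (fun ξ : ℝ => ((1 + |ξ| ^ δ : ℝ) : ℂ) * fourierPull ψ v ξ) 2 volume}

def fourierSemi (ψ : ℝ → ℝ) (δ : ℝ) (v : ℝ → ℝ) : ℝ :=
  Real.sqrt (∫ ξ : ℝ, (|ξ| ^ δ * ‖fourierPull ψ v ξ‖) ^ 2)

def fourierNorm (ψ : ℝ → ℝ) (δ : ℝ) (v : ℝ → ℝ) : ℝ :=
  Real.sqrt (norm2 ψ v ^ 2 + fourierSemi ψ δ v ^ 2)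

end PsiFrac

end

namespace PsiFrac

open Topology ComplexConjugate
open scoped SchwartzMap

/-! The substitution `s = ψ t` is an isometry of `L²_ψ(ℝ)` onto `L²(ℝ)`. It turns `(1/ψ') d/dt` into
`d/ds` and the fractional integrals into convolutions with one-sided power kernels, so everything
reduces to the unweighted line and no constant depends on `ψ`.

There, the derivative with sign `σ` (`1` left, `-1` right) is the Fourier multiplier `(2πiση)^δ`.
For test functions this is `lineRL_eq_fourierInv`: damp the kernel by `e^{-ε|y|}`, apply the
convolution theorem, let `ε → 0`. By Parseval and duality it passes to weak derivatives
(`realFourier_ae_eq_of_weak`, `exists_weak_of_memLp`).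

Both multipliers have modulus `|2πη|^δ`, so the left, right and Fourier spaces coincide, and the
left and right semi-norms are equal and proportional to the Fourier one. In the scalar product of
the two derivatives, the multipliers combine to `(2πiη)^{2δ}`, whose real part is `cos(πδ)
|2πη|^{2δ}`. So the mixed semi-norm is `√|cos(πδ)|` times the left one, and this factor is nonzero
precisely when `δ` is not a half-integer. -/

/-! ### Inverse Fourier transform on `L¹ ∩ L²`. -/

/-- The `L²` inverse Fourier transform agrees with the integral one on `L¹ ∩ L²`. -/
theorem fourierInv_toLp_ae_eq {m : ℝ → ℂ} (h1 : Integrable m) (h2 : MemLp m 2 volume) :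
    ((𝓕⁻ (h2.toLp m) : Lp ℂ 2 (volume : Measure ℝ)) : ℝ → ℂ) =ᵐ[volume] 𝓕⁻ m := by
  have hcont : Continuous (𝓕⁻ m) :=
    VectorFourier.fourierIntegral_continuous (e := Real.fourierChar) (L := -innerₗ ℝ)
      Real.continuous_fourierChar (by simp; fun_prop) h1
  refine ae_eq_of_integral_contDiff_smul_eq
    ((Lp.memLp _).locallyIntegrable one_le_two) hcont.locallyIntegrable fun g hg hgc => ?_
  have hg₁ : HasCompactSupport (Complex.ofRealCLM ∘ g) := hgc.comp_left rfl
  have hg₂ : ContDiff ℝ ∞ (Complex.ofRealCLM ∘ g) := by fun_prop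
  let G := hg₁.toSchwartzMap hg₂
  have hG : ∀ x, G x = (g x : ℂ) := fun x => rfl
  -- The `L²` inverse, read as a tempered distribution, puts `𝓕⁻` on the test function; `e3`
  -- (Fubini) moves it back onto `m`.
  have e1 := congrArg (fun T => T G) (Lp.fourierInv_toTemperedDistribution_eq (h2.toLp m))
  simp only [TemperedDistribution.fourierInv_apply, Lp.toTemperedDistribution_apply] at e1
  have e2 : ∫ x, (𝓕⁻ G) x • (h2.toLp m : ℝ → ℂ) x = ∫ x, (𝓕⁻ (fun y => (g y : ℂ))) x • m x := by
    refine integral_congr_ae ?_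
    filter_upwards [h2.coeFn_toLp] with x hx
    rw [hx, SchwartzMap.fourierInv_coe]
    rfl
  rw [e2] at e1
  have hgi : Integrable (fun y => (g y : ℂ)) := (hg₂.continuous.integrable_of_hasCompactSupport hg₁)
  have e3 := VectorFourier.integral_fourierIntegral_smul_eq_flip (e := Real.fourierChar)
    (L := -innerₗ ℝ) (μ := volume) (ν := volume) Real.continuous_fourierChar
    (by simp; fun_prop) hgi h1
  have hflip : (-innerₗ ℝ : ℝ →ₗ[ℝ] ℝ →ₗ[ℝ] ℝ).flip = -innerₗ ℝ := by
    ext; simp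
  rw [hflip] at e3
  have e4 : ∫ x, (𝓕⁻ (fun y => (g y : ℂ))) x • m x = ∫ x, (g x : ℂ) • (𝓕⁻ m) x := e3
  rw [e4] at e1
  calc ∫ x, g x • ((𝓕⁻ (h2.toLp m) : Lp ℂ 2 (volume : Measure ℝ)) : ℝ → ℂ) x
      = ∫ x, G x • ((𝓕⁻ (h2.toLp m) : Lp ℂ 2 (volume : Measure ℝ)) : ℝ → ℂ) x := by
        simp [hG]
    _ = ∫ x, g x • 𝓕⁻ m x := by rw [← e1]; simp

theorem ae_eq_zero_of_fourierInv_eq_zero {m : ℝ → ℂ} (h1 : Integrable m) (h2 : MemLp m 2 volume)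
    (h : ∀ a, 𝓕⁻ m a = 0) : m =ᵐ[volume] 0 := by
  have e := fourierInv_toLp_ae_eq h1 h2
  have e0 : (𝓕⁻ (h2.toLp m) : Lp ℂ 2 (volume : Measure ℝ)) = 0 := by
    rw [Lp.eq_zero_iff_ae_eq_zero]
    filter_upwards [e] with x hx
    rw [hx, h x]; rfl
  have e1 : h2.toLp m = 0 := by
    have h3 : 𝓕 (𝓕⁻ (h2.toLp m) : Lp ℂ 2 (volume : Measure ℝ)) = h2.toLp m :=
      fourier_fourierInv_eq (h2.toLp m)
    rw [← h3, e0]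
    exact (Lp.fourierTransformₗᵢ ℝ ℂ).map_zero
  filter_upwards [h2.coeFn_toLp, (Lp.eq_zero_iff_ae_eq_zero.1 e1)] with x hx hx'
  rw [← hx, hx']

theorem memLp_fourierInv {m : ℝ → ℂ} (h1 : Integrable m) (h2 : MemLp m 2 volume) :
    MemLp (𝓕⁻ m) 2 volume :=
  (Lp.memLp _).ae_eq (fourierInv_toLp_ae_eq h1 h2)

theorem fourier_toLp_fourierInv {m u : ℝ → ℂ} (h1 : Integrable m) (h2 : MemLp m 2 volume)
    (hu : u = 𝓕⁻ m) (h : MemLp u 2 volume) :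
    (𝓕 (h.toLp u) : Lp ℂ 2 (volume : Measure ℝ)) = h2.toLp m := by
  subst hu
  have : h.toLp _ = 𝓕⁻ (h2.toLp m) := by
    refine Lp.ext ?_
    filter_upwards [h.coeFn_toLp, fourierInv_toLp_ae_eq h1 h2] with x h1 h2
    rw [h1, h2]
  rw [this, fourier_fourierInv_eq]

/-! ### Euler's Gamma integral in the right half-plane. -/

/-- Euler's integral `∫₀^∞ t^{a-1} e^{-zt} dt = z^{-a} Γ(a)` for complex `z` in the right half-plane. -/
theorem integral_rpow_mul_cexp_neg_mul_Ioi {a : ℝ} (ha : 0 < a) {z : ℂ} (hz : 0 < z.re) :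
    ∫ t in Ioi (0 : ℝ), ((t ^ (a - 1) : ℝ) : ℂ) * Complex.exp (-z * t)
      = z ^ (-a : ℂ) * Real.Gamma a := by
  set F : ℂ → ℂ := fun z => ∫ t in Ioi (0 : ℝ), ((t ^ (a - 1) : ℝ) : ℂ) * Complex.exp (-z * t)
  have hopen : IsOpen {z : ℂ | 0 < z.re} := isOpen_lt continuous_const Complex.continuous_re
  have hmeas : ∀ z : ℂ, AEStronglyMeasurable
      (fun t : ℝ => ((t ^ (a - 1) : ℝ) : ℂ) * Complex.exp (-z * t)) (volume.restrict (Ioi 0)) := by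
    intro z
    exact (by fun_prop : Measurable fun t : ℝ => ((t ^ (a - 1) : ℝ) : ℂ) *
      Complex.exp (-z * t)).aestronglyMeasurable
  have hint : ∀ (b : ℝ), 0 < b → ∀ r : ℝ, 0 < r →
      IntegrableOn (fun t : ℝ => t ^ (b - 1) * Real.exp (-r * t)) (Ioi 0) := by
    intro b hb r hr
    have := integrableOn_rpow_mul_exp_neg_mul_rpow (s := b - 1) (p := 1) (b := r) (by linarith)
      one_pos hr
    simpa using this
  have hnorm : ∀ (z : ℂ) (t : ℝ), ‖Complex.exp (-z * t)‖ = Real.exp (-z.re * t) := by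
    intro z t
    rw [Complex.norm_exp]; simp
  have hdiff : DifferentiableOn ℂ F {z : ℂ | 0 < z.re} := by
    intro z hz
    have hz' : 0 < z.re := hz
    refine DifferentiableAt.differentiableWithinAt ?_
    have := hasDerivAt_integral_of_dominated_loc_of_deriv_le
      (μ := volume.restrict (Ioi (0 : ℝ)))
      (F := fun (z : ℂ) (t : ℝ) => ((t ^ (a - 1) : ℝ) : ℂ) * Complex.exp (-z * t))
      (F' := fun (z : ℂ) (t : ℝ) => ((t ^ (a - 1) : ℝ) : ℂ) * (Complex.exp (-z * t) * (-t)))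
      (x₀ := z) (s := {w : ℂ | z.re / 2 < w.re})
      (bound := fun t : ℝ => t ^ ((a + 1) - 1) * Real.exp (-(z.re / 2) * t))
      ((isOpen_lt continuous_const Complex.continuous_re).mem_nhds
        (by simp only [mem_ofPred_eq]; linarith))
      (Eventually.of_forall fun w => hmeas w) ?_ ?_ ?_ (hint _ (by linarith) _ (by linarith)) ?_
    · exact this.2.differentiableAt
    · refine (hint a ha z.re hz').mono' (hmeas z) ?_
      refine (ae_restrict_iff' measurableSet_Ioi).2 (Eventually.of_forall fun t ht => ?_)
      rw [norm_mul, hnorm, Complex.norm_real, Real.norm_of_nonneg (Real.rpow_nonneg (le_of_lt ht) _)]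
    · exact (by fun_prop : Measurable fun t : ℝ => ((t ^ (a - 1) : ℝ) : ℂ) *
        (Complex.exp (-z * t) * (-t))).aestronglyMeasurable
    -- The half-plane `Re w > Re z / 2` is a neighbourhood of `z` with uniform exponential decay;
    -- differentiation brings down a factor `t`, hence the exponent `(a + 1) - 1` in the bound.
    · refine (ae_restrict_iff' measurableSet_Ioi).2 (Eventually.of_forall fun t ht w hw => ?_)
      have ht' : 0 < t := ht
      have hw' : z.re / 2 < w.re := hw
      rw [norm_mul, norm_mul, hnorm, Complex.norm_real, norm_neg, Complex.norm_real,
        Real.norm_of_nonneg (Real.rpow_nonneg ht'.le _), Real.norm_of_nonneg ht'.le,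
        show a + 1 - 1 = (a - 1) + 1 by ring, Real.rpow_add_one ht'.ne']
      have : Real.exp (-w.re * t) ≤ Real.exp (-(z.re / 2) * t) := by
        apply Real.exp_le_exp.2; nlinarith
      have h0 : 0 ≤ t ^ (a - 1) := Real.rpow_nonneg ht'.le _
      calc t ^ (a - 1) * (Real.exp (-w.re * t) * t)
          ≤ t ^ (a - 1) * (Real.exp (-(z.re / 2) * t) * t) := by gcongr
        _ = _ := by ring
    · refine Eventually.of_forall fun t w hw => ?_
      refine HasDerivAt.const_mul _ ?_
      have : HasDerivAt (fun z : ℂ => -z * (t : ℂ)) (-(t : ℂ)) w := by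
        simpa using (hasDerivAt_id w).neg.mul_const (t : ℂ)
      exact this.cexp
  have hdiff2 : DifferentiableOn ℂ (fun z : ℂ => z ^ (-a : ℂ) * Real.Gamma a)
      {z : ℂ | 0 < z.re} := by
    intro z hz
    exact ((differentiableAt_id.cpow_const (Or.inl hz)).mul_const _).differentiableWithinAt
  have hreal : ∀ r : ℝ, 0 < r → F r = (r : ℂ) ^ (-a : ℂ) * Real.Gamma a := by
    intro r hr
    have h := Real.integral_rpow_mul_exp_neg_mul_Ioi ha hr
    have : F r = ((∫ t in Ioi (0 : ℝ), t ^ (a - 1) * Real.exp (-(r * t)) : ℝ) : ℂ) := by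
      refine Eq.trans ?_ (integral_ofReal (𝕜 := ℂ))
      refine integral_congr_ae (Eventually.of_forall fun t => ?_)
      simp
    rw [this, h, one_div, Real.inv_rpow hr.le, ← Real.rpow_neg hr.le, Complex.ofReal_mul,
      Complex.ofReal_cpow hr.le]
    simp
  -- Identity theorem: both sides are holomorphic and agree on the positive reals, here along the
  -- points `1 + 1/(n+1)` accumulating at `1`.
  refine AnalyticOnNhd.eqOn_of_preconnected_of_frequently_eq (hdiff.analyticOnNhd hopen)
    (hdiff2.analyticOnNhd hopen) (convex_halfSpace_re_gt 0).isPreconnected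
    (z₀ := 1) (by simp) ?_ hz
  have ht : Tendsto (fun n : ℕ => (((1 + 1 / ((n : ℝ) + 1) : ℝ)) : ℂ)) atTop (𝓝[≠] 1) := by
    refine tendsto_nhdsWithin_iff.2 ⟨?_, Eventually.of_forall fun n => ?_⟩
    · have := (tendsto_const_nhds (x := (1 : ℝ))).add
        (tendsto_one_div_add_atTop_nhds_zero_nat (𝕜 := ℝ))
      rw [add_zero] at this
      exact (Complex.continuous_ofReal.tendsto 1).comp this
    · simp only [mem_compl_iff, mem_singleton_iff]
      intro h
      have h' : (1 + 1 / ((n : ℝ) + 1) : ℝ) = 1 := by exact_mod_cast h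
      have : (0 : ℝ) < 1 / ((n : ℝ) + 1) := by positivity
      linarith
  exact ht.frequently (Frequently.of_forall fun n => hreal _ (by positivity))

/-! ### Kernels and derivatives on the unweighted line. -/

/-- The one-sided kernel `|y|^{α-1} / Γ(α)` on the half-line `σ y > 0`. -/
noncomputable def kernel (σ α y : ℝ) : ℝ :=
  (Ioi (0 : ℝ)).indicator (fun t => t ^ (α - 1) / Real.Gamma α) (σ * y)

/-- The operator `σ d/ds`. -/
noncomputable def signedDeriv (σ : ℝ) (f : ℝ → ℝ) : ℝ → ℝ := fun t => σ * deriv f t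

/-- The unweighted Riemann–Liouville derivative, left for `σ = 1` and right for `σ = -1`. -/
noncomputable def lineRL (σ δ : ℝ) (φ : ℝ → ℝ) : ℝ → ℝ :=
  (signedDeriv σ)^[order δ] (fun s => ∫ y, kernel σ (order δ - δ) y * φ (s - y))

/-- The Fourier multiplier `(2πiση)^δ`. -/
noncomputable def symbol (σ δ η : ℝ) : ℂ := (2 * Real.pi * Complex.I * (σ * η : ℝ)) ^ (δ : ℂ)

theorem contDiff_signedDeriv (σ : ℝ) {φ : ℝ → ℝ} (h : ContDiff ℝ ∞ φ) :
    ContDiff ℝ ∞ (signedDeriv σ φ) :=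
  contDiff_const.mul ((contDiff_infty_iff_deriv.1 h).2)

theorem hasCompactSupport_signedDeriv (σ : ℝ) {φ : ℝ → ℝ} (h : HasCompactSupport φ) :
    HasCompactSupport (signedDeriv σ φ) :=
  (h.deriv (𝕜 := ℝ)).mul_left

theorem contDiff_iterate_signedDeriv (σ : ℝ) (n : ℕ) {φ : ℝ → ℝ} (h : ContDiff ℝ ∞ φ) :
    ContDiff ℝ ∞ ((signedDeriv σ)^[n] φ) := by
  induction n with
  | zero => exact h
  | succ n ih => rw [Function.iterate_succ_apply']; exact contDiff_signedDeriv σ ih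

theorem hasCompactSupport_iterate_signedDeriv (σ : ℝ) (n : ℕ) {φ : ℝ → ℝ}
    (h : HasCompactSupport φ) : HasCompactSupport ((signedDeriv σ)^[n] φ) := by
  induction n with
  | zero => exact h
  | succ n ih => rw [Function.iterate_succ_apply']; exact hasCompactSupport_signedDeriv σ ih

/-- All derivatives fall on the test function, so the kernel need only be locally integrable. -/
theorem iterate_signedDeriv_convolution {k : ℝ → ℝ} (hk : LocallyIntegrable k) (σ : ℝ) (n : ℕ)
    {φ : ℝ → ℝ} (h : ContDiff ℝ ∞ φ) (hc : HasCompactSupport φ) :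
    (signedDeriv σ)^[n] (fun s => ∫ y, k y * φ (s - y))
      = fun s => ∫ y, k y * (signedDeriv σ)^[n] φ (s - y) := by
  induction n with
  | zero => rfl
  | succ n ih =>
    rw [Function.iterate_succ_apply', ih]
    funext s
    have := HasCompactSupport.hasDerivAt_convolution_right (ContinuousLinearMap.mul ℝ ℝ) hk
      (hasCompactSupport_iterate_signedDeriv σ n hc)
      ((contDiff_iterate_signedDeriv σ n h).of_le (by simp)) s
    have h2 : deriv (fun s => ∫ y, k y * (signedDeriv σ)^[n] φ (s - y)) s
        = ∫ y, k y * deriv ((signedDeriv σ)^[n] φ) (s - y) := this.deriv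
    simp only [signedDeriv, Function.iterate_succ_apply'] at h2 ⊢
    rw [h2, ← integral_const_mul]
    congr 1; funext y; ring

theorem ofReal_compactSupport {φ : ℝ → ℝ} (hc : HasCompactSupport φ) :
    HasCompactSupport (fun s => (φ s : ℂ)) := hc.comp_left (g := Complex.ofReal) rfl

theorem ofReal_contDiff {φ : ℝ → ℝ} (h : ContDiff ℝ ∞ φ) :
    ContDiff ℝ ∞ (fun s => (φ s : ℂ)) := Complex.ofRealCLM.contDiff.comp h

theorem ofReal_integrable {φ : ℝ → ℝ} (h : ContDiff ℝ ∞ φ) (hc : HasCompactSupport φ) :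
    Integrable (fun s => (φ s : ℂ)) :=
  (ofReal_contDiff h).continuous.integrable_of_hasCompactSupport (ofReal_compactSupport hc)

theorem fourier_iterate_signedDeriv (σ : ℝ) (n : ℕ) {φ : ℝ → ℝ} (h : ContDiff ℝ ∞ φ)
    (hc : HasCompactSupport φ) (η : ℝ) :
    𝓕 (fun s => (((signedDeriv σ)^[n] φ s : ℝ) : ℂ)) η
      = (2 * Real.pi * Complex.I * (σ * η : ℝ)) ^ n * 𝓕 (fun s => (φ s : ℂ)) η := by
  induction n with
  | zero => simp
  | succ n ih =>
    set χ := (signedDeriv σ)^[n] φ with hχ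
    have hs := contDiff_iterate_signedDeriv σ n h
    have hcs := hasCompactSupport_iterate_signedDeriv σ n hc
    rw [← hχ] at hs hcs
    have hd : deriv (fun s => (χ s : ℂ)) = fun s => ((deriv χ s : ℝ) : ℂ) := by
      funext s
      exact ((hs.differentiable (by simp) s).hasDerivAt.ofReal_comp).deriv
    have e := Real.fourier_deriv (ofReal_integrable hs hcs)
      ((ofReal_contDiff hs).differentiable (by simp))
      (by rw [hd]; exact ofReal_integrable ((contDiff_infty_iff_deriv.1 hs).2) hcs.deriv)
    rw [hd] at e
    have e' := congrFun e η
    have : (fun s => (((signedDeriv σ)^[n + 1] φ s : ℝ) : ℂ))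
        = (σ : ℂ) • fun s => ((deriv χ s : ℝ) : ℂ) := by
      funext s
      rw [Function.iterate_succ_apply', ← hχ]
      simp [signedDeriv]
    rw [this]
    have e2 : 𝓕 ((σ : ℂ) • fun s => ((deriv χ s : ℝ) : ℂ)) η
        = (σ : ℂ) * 𝓕 (fun s => ((deriv χ s : ℝ) : ℂ)) η := by
      rw [Real.fourier_eq, Real.fourier_eq, ← smul_eq_mul, ← integral_smul]
      congr 1; funext s
      simp only [Pi.smul_apply]
      rw [smul_comm]
    rw [e2, e', ih]
    simp only [smul_eq_mul]
    push_cast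
    ring

/-! ### The regularised kernel -/

theorem measurable_kernel (σ α : ℝ) : Measurable (kernel σ α) := by
  unfold kernel
  exact (Measurable.indicator (by fun_prop) measurableSet_Ioi).comp (by fun_prop)

/-- For `α > 0` the kernel is integrable at `0` but not at infinity; the exponential repairs the
latter. -/
theorem integrable_kernel_mul_exp {σ α ε : ℝ} (hσ : σ = 1 ∨ σ = -1) (hα : 0 < α) (hε : 0 < ε) :
    Integrable (fun y => kernel σ α y * Real.exp (-ε * |y|)) := by
  have h1 : Integrable (fun y => kernel 1 α y * Real.exp (-ε * |y|)) := by
    have := integrableOn_rpow_mul_exp_neg_mul_rpow (s := α - 1) (p := 1) (b := ε) (by linarith)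
      one_pos hε
    have h2 := (integrable_indicator_iff measurableSet_Ioi).2 (this.const_mul (1 / Real.Gamma α))
    refine h2.congr (Eventually.of_forall fun y => ?_)
    by_cases hy : 0 < y
    · simp [kernel, indicator, hy, abs_of_pos hy]; ring
    · simp [kernel, indicator, hy]
  rcases hσ with rfl | rfl
  · exact h1
  · refine h1.comp_neg.congr (Eventually.of_forall fun y => ?_)
    simp [kernel]

theorem locallyIntegrable_kernel {σ α : ℝ} (hσ : σ = 1 ∨ σ = -1) (hα : 0 < α) :
    LocallyIntegrable (kernel σ α) := by
  have h := (integrable_kernel_mul_exp hσ hα one_pos).locallyIntegrable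
  rw [← locallyIntegrableOn_univ] at h ⊢
  have := h.continuousOn_mul (g := fun y => Real.exp |y|) (by fun_prop)
    isOpen_univ.isLocallyClosed
  have e : kernel σ α = fun y => Real.exp |y| * (kernel σ α y * Real.exp (-1 * |y|)) := by
    funext y
    rw [mul_comm, mul_assoc, ← Real.exp_add]
    simp
  rw [e]
  exact this

/-- For `σ = 1` this is Euler's integral at `z = ε + 2πiη`; the case `σ = -1` follows by the
reflection `y ↦ -y`. -/
theorem fourier_kernel_mul_exp {σ α ε : ℝ} (hσ : σ = 1 ∨ σ = -1) (hα : 0 < α) (hε : 0 < ε)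
    (η : ℝ) : 𝓕 (fun y => ((kernel σ α y * Real.exp (-ε * |y|) : ℝ) : ℂ)) η
      = (ε + 2 * Real.pi * Complex.I * (σ * η : ℝ)) ^ (-α : ℂ) := by
  have key : ∀ η : ℝ, 𝓕 (fun y => ((kernel 1 α y * Real.exp (-ε * |y|) : ℝ) : ℂ)) η
      = (ε + 2 * Real.pi * Complex.I * η) ^ (-α : ℂ) := by
    intro η
    have hz : 0 < (ε + 2 * Real.pi * Complex.I * η : ℂ).re := by simpa using hε
    have h := integral_rpow_mul_cexp_neg_mul_Ioi hα hz
    have hΓ : (Real.Gamma α : ℂ) ≠ 0 := by exact_mod_cast (Real.Gamma_pos_of_pos hα).ne'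
    rw [← div_eq_iff hΓ, ← integral_div] at h
    rw [← h, Real.fourier_eq', ← integral_indicator measurableSet_Ioi]
    congr 1; funext y
    by_cases hy : 0 < y
    · simp only [kernel, indicator, mem_Ioi, hy, one_mul, if_true, abs_of_pos hy, smul_eq_mul]
      have : Complex.exp (-(ε + 2 * Real.pi * Complex.I * η) * y)
          = Complex.exp (((-2 * Real.pi * inner ℝ y η : ℝ) : ℂ) * Complex.I)
            * ((Real.exp (-ε * y) : ℝ) : ℂ) := by
        rw [Complex.ofReal_exp, ← Complex.exp_add]
        congr 1
        simp
        ring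
      rw [this]
      push_cast
      ring
    · simp [kernel, indicator, hy]
  rcases hσ with rfl | rfl
  · simpa using key η
  · have h2 := key (-η)
    rw [Real.fourier_eq'] at h2 ⊢
    rw [← integral_neg_eq_self] at h2
    have e : (-1 * η : ℝ) = -η := by ring
    rw [e, ← h2]
    congr 1; funext y
    simp [kernel]

/-! ### The multiplier -/

theorem norm_symbol {σ : ℝ} (hσ : σ = 1 ∨ σ = -1) (δ η : ℝ) :
    ‖symbol σ δ η‖ = (2 * Real.pi * |η|) ^ δ := by
  rw [symbol, Complex.norm_cpow_real]
  congr 1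
  have : |σ| = 1 := by rcases hσ with rfl | rfl <;> simp
  simp [this, abs_of_pos Real.pi_pos]

theorem measurable_symbol (σ δ : ℝ) : Measurable (symbol σ δ) := by
  unfold symbol; fun_prop

/-- The symbol need not be smooth at `0`, so the product need not be Schwartz. It is dominated by
`|G| + |(2πη)^n G|` with `n ≥ δ`, a sum of moduli of Schwartz functions. -/
theorem memLp_symbol_mul {σ δ : ℝ} (hσ : σ = 1 ∨ σ = -1) (hδ : 0 < δ) (G : 𝓢(ℝ, ℂ))
    (p : ENNReal) : MemLp (fun η => symbol σ δ η * G η) p volume := by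
  obtain ⟨n, hn⟩ := exists_nat_ge δ
  have ht : Function.HasTemperateGrowth (fun x : ℝ => ((2 * Real.pi * x : ℝ) : ℂ) ^ n) := by
    fun_prop
  set H := SchwartzMap.smulLeftCLM ℂ (fun x : ℝ => ((2 * Real.pi * x : ℝ) : ℂ) ^ n) G with hH
  have h1 := (G.memLp p volume).norm.add (H.memLp p volume).norm
  refine h1.mono ((measurable_symbol σ δ).aestronglyMeasurable.mul
    G.continuous.aestronglyMeasurable) (Eventually.of_forall fun η => ?_)
  have hHη : ‖H η‖ = (2 * Real.pi * |η|) ^ n * ‖G η‖ := by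
    rw [hH, SchwartzMap.smulLeftCLM_apply_apply ht]
    simp [abs_of_pos Real.pi_pos]
  rw [norm_mul, norm_symbol hσ]
  simp only [Pi.add_apply]
  rw [hHη, Real.norm_of_nonneg (by positivity)]
  set x := 2 * Real.pi * |η| with hx
  have hx0 : 0 ≤ x := by positivity
  have : x ^ δ ≤ 1 + x ^ n := by
    rcases le_total x 1 with h | h
    · have := Real.rpow_le_one hx0 h hδ.le
      have := pow_nonneg hx0 n
      linarith
    · have := Real.rpow_le_rpow_of_exponent_le h hn
      rw [Real.rpow_natCast] at this
      linarith
  calc x ^ δ * ‖G η‖ ≤ (1 + x ^ n) * ‖G η‖ := by gcongr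
    _ = _ := by ring

/-- A smooth compactly supported real function as a complex Schwartz function. -/
noncomputable def toSchwartz {φ : ℝ → ℝ} (h : ContDiff ℝ ∞ φ) (hc : HasCompactSupport φ) :
    𝓢(ℝ, ℂ) := (ofReal_compactSupport hc).toSchwartzMap (ofReal_contDiff h)

theorem fourier_toSchwartz {φ : ℝ → ℝ} (h : ContDiff ℝ ∞ φ) (hc : HasCompactSupport φ) :
    ((𝓕 (toSchwartz h hc) : 𝓢(ℝ, ℂ)) : ℝ → ℂ) = 𝓕 (fun s => (φ s : ℂ)) := by
  rw [SchwartzMap.fourier_coe]; rfl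

theorem memLp_symbol_mul_fourier {σ δ : ℝ} (hσ : σ = 1 ∨ σ = -1) (hδ : 0 < δ) {φ : ℝ → ℝ}
    (h : ContDiff ℝ ∞ φ) (hc : HasCompactSupport φ) (p : ENNReal) :
    MemLp (fun η => symbol σ δ η * 𝓕 (fun s => (φ s : ℂ)) η) p volume := by
  rw [← fourier_toSchwartz h hc]
  exact memLp_symbol_mul hσ hδ _ p

theorem memLp_fourier {φ : ℝ → ℝ} (h : ContDiff ℝ ∞ φ) (hc : HasCompactSupport φ)
    (p : ENNReal) : MemLp (𝓕 (fun s => (φ s : ℂ))) p volume := by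
  rw [← fourier_toSchwartz h hc]
  exact SchwartzMap.memLp _ p volume

theorem order_sub_pos {δ : ℝ} : 0 < (order δ : ℝ) - δ := by
  have := Nat.lt_floor_add_one δ
  simp only [order]; push_cast; linarith

/-- Since `z = 2πiση` is imaginary, `|z| ≤ |ε + z|`, and the exponent `-(n - δ)` is negative. This
gives a majorant independent of `ε`. At `z = 0` both sides vanish because `order δ ≥ 1`. -/
theorem norm_regularised_symbol_le {σ δ ε : ℝ} (hσ : σ = 1 ∨ σ = -1) (hδ : 0 < δ)
    (η : ℝ) : ‖((ε : ℂ) + 2 * Real.pi * Complex.I * (σ * η : ℝ)) ^ (-((order δ - δ : ℝ) : ℂ))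
      * (2 * Real.pi * Complex.I * (σ * η : ℝ)) ^ order δ‖ ≤ ‖symbol σ δ η‖ := by
  rw [norm_symbol hσ]
  set z : ℂ := 2 * Real.pi * Complex.I * (σ * η : ℝ) with hz
  have hσ' : |σ| = 1 := by rcases hσ with rfl | rfl <;> simp
  have hnz : ‖z‖ = 2 * Real.pi * |η| := by simp [hz, hσ', abs_of_pos Real.pi_pos]
  have hre : z.re = 0 := by simp [hz]
  rw [← hnz, norm_mul, norm_pow, ← Complex.ofReal_neg, Complex.norm_cpow_real]
  rcases eq_or_ne z 0 with h0 | h0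
  · rw [h0]; simp [order, Real.zero_rpow hδ.ne']
  · have hzp : 0 < ‖z‖ := norm_pos_iff.2 h0
    have hle : ‖z‖ ≤ ‖(ε : ℂ) + z‖ := by
      have hi : |z.im| = ‖z‖ := (Complex.abs_im_eq_norm.2 hre)
      have := Complex.abs_im_le_norm ((ε : ℂ) + z)
      simp only [Complex.add_im, Complex.ofReal_im, zero_add] at this
      linarith
    have h1 := Real.rpow_le_rpow_of_nonpos hzp hle (z := -(order δ - δ))
      (by have := order_sub_pos (δ := δ); linarith)
    calc ‖(ε : ℂ) + z‖ ^ (-(order δ - δ)) * ‖z‖ ^ order δ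
        ≤ ‖z‖ ^ (-(order δ - δ)) * ‖z‖ ^ order δ := by gcongr
      _ = ‖z‖ ^ δ := by
        rw [← Real.rpow_natCast ‖z‖ (order δ), ← Real.rpow_add hzp]
        congr 1; ring

/-- For `η ≠ 0` the imaginary part is nonzero, so `z` stays off the branch cut of the power. -/
theorem tendsto_regularised_symbol {σ δ η : ℝ} (hσ : σ = 1 ∨ σ = -1) (hη : η ≠ 0) :
    Tendsto (fun ε : ℝ => ((ε : ℂ) + 2 * Real.pi * Complex.I * (σ * η : ℝ)) ^
      (-((order δ - δ : ℝ) : ℂ)) * (2 * Real.pi * Complex.I * (σ * η : ℝ)) ^ order δ)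
      (𝓝[>] 0) (𝓝 (symbol σ δ η)) := by
  rw [symbol]
  set z : ℂ := 2 * Real.pi * Complex.I * (σ * η : ℝ) with hz
  have hσ' : σ ≠ 0 := by rcases hσ with rfl | rfl <;> simp
  have him : z.im ≠ 0 := by
    simp [hz, Real.pi_ne_zero, hσ', hη]
  have h0 : z ≠ 0 := fun h => him (by rw [h]; rfl)
  have e : z ^ (δ : ℂ) = ((0 : ℝ) + z : ℂ) ^ (-((order δ - δ : ℝ) : ℂ)) * z ^ order δ := by
    rw [Complex.ofReal_zero, zero_add, ← Complex.cpow_natCast z (order δ), ← Complex.cpow_add _ _ h0]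
    congr 1; push_cast; ring
  rw [e]
  refine (Tendsto.mul_const _ ?_).mono_left nhdsWithin_le_nhds
  have hc : ContinuousAt (fun ε : ℝ => ((ε : ℂ) + z) ^ (-((order δ - δ : ℝ) : ℂ))) 0 := by
    refine ContinuousAt.cpow (by fun_prop) continuousAt_const ?_
    right; simpa using him
  exact hc

/-! ### The multiplier formula for test functions. -/

/-- The Riemann–Liouville derivative of a test function is the Fourier multiplier `(2πiση)^δ`. -/
theorem lineRL_eq_fourierInv {σ δ : ℝ} (hσ : σ = 1 ∨ σ = -1) (hδ : 0 < δ) {φ : ℝ → ℝ}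
    (h : ContDiff ℝ ∞ φ) (hc : HasCompactSupport φ) :
    (fun s => (lineRL σ δ φ s : ℂ))
      = 𝓕⁻ (fun η => symbol σ δ η * 𝓕 (fun s => (φ s : ℂ)) η) := by
  set n := order δ with hn
  have hα : 0 < (order δ : ℝ) - δ := order_sub_pos
  set α : ℝ := (order δ : ℝ) - δ with hαd
  have hk := locallyIntegrable_kernel hσ hα
  set Ψ : ℝ → ℝ := (signedDeriv σ)^[n] φ with hΨ
  have hs : ContDiff ℝ ∞ Ψ := contDiff_iterate_signedDeriv σ n h
  have hcs : HasCompactSupport Ψ := hasCompactSupport_iterate_signedDeriv σ n hc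
  funext s
  have hT : (lineRL σ δ φ s : ℂ) = ∫ y, ((kernel σ α y * Ψ (s - y) : ℝ) : ℂ) := by
    rw [lineRL, iterate_signedDeriv_convolution hk σ n h hc]
    exact (integral_ofReal (𝕜 := ℂ)).symm
  have hconv : Integrable (fun y => kernel σ α y * Ψ (s - y)) :=
    (hcs.convolutionExists_right (ContinuousLinearMap.mul ℝ ℝ) hk hs.continuous) s
  set S : ℝ → ℝ → ℂ := fun ε η => ((ε : ℂ) + 2 * Real.pi * Complex.I * (σ * η : ℝ)) ^
      (-(α : ℂ)) * (2 * Real.pi * Complex.I * (σ * η : ℝ)) ^ n with hS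
  have hdom := memLp_one_iff_integrable.1 (memLp_symbol_mul_fourier hσ hδ h hc 1)
  have hle : ∀ ε η, ‖S ε η * 𝓕 (fun s => (φ s : ℂ)) η‖
      ≤ ‖symbol σ δ η * 𝓕 (fun s => (φ s : ℂ)) η‖ := by
    intro ε η
    rw [norm_mul (S ε η), norm_mul (symbol σ δ η)]
    exact mul_le_mul_of_nonneg_right (norm_regularised_symbol_le hσ hδ η)
      (norm_nonneg (𝓕 (fun s => (φ s : ℂ)) η))
  have hmeasS : ∀ ε, AEStronglyMeasurable (fun η => S ε η * 𝓕 (fun s => (φ s : ℂ)) η) := by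
    intro ε
    refine AEStronglyMeasurable.mul ?_ (memLp_fourier h hc 1).1
    exact (by fun_prop : Measurable (S ε)).aestronglyMeasurable
  -- For `ε > 0` both convolution factors are integrable, so the convolution theorem and pointwise
  -- Fourier inversion apply.
  have hinv : ∀ ε, 0 < ε → ∫ y, ((kernel σ α y * Real.exp (-ε * |y|) : ℝ) : ℂ) * (Ψ (s - y) : ℂ)
      = 𝓕⁻ (fun η => S ε η * 𝓕 (fun s => (φ s : ℂ)) η) s := by
    intro ε hε
    have hki : Integrable (fun y => ((kernel σ α y * Real.exp (-ε * |y|) : ℝ) : ℂ)) :=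
      (integrable_kernel_mul_exp hσ hα hε).ofReal
    have hΨi := ofReal_integrable hs hcs
    have hui := hki.integrable_convolution (ContinuousLinearMap.mul ℂ ℂ) hΨi
    have hF : 𝓕 (convolution (fun y => ((kernel σ α y * Real.exp (-ε * |y|) : ℝ) : ℂ))
        (fun s => (Ψ s : ℂ)) (ContinuousLinearMap.mul ℂ ℂ) volume)
        = fun η => S ε η * 𝓕 (fun s => (φ s : ℂ)) η := by
      funext η
      rw [Real.fourier_mul_convolution_eq hki hΨi, fourier_kernel_mul_exp hσ hα hε,
        fourier_iterate_signedDeriv σ n h hc]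
      simp only [hS]
      ring
    have hcont := (ofReal_compactSupport hcs).continuous_convolution_right
      (ContinuousLinearMap.mul ℂ ℂ) hki.locallyIntegrable (ofReal_contDiff hs).continuous
    rw [← hF]
    refine (hui.fourierInv_fourier_eq ?_ hcont.continuousAt).symm
    rw [hF]
    exact hdom.mono (hmeasS ε) (Eventually.of_forall (hle ε))
  have hlim_conv : Tendsto (fun ε : ℝ => ∫ y, ((kernel σ α y * Real.exp (-ε * |y|) : ℝ) : ℂ)
      * (Ψ (s - y) : ℂ)) (𝓝[>] 0) (𝓝 (lineRL σ δ φ s : ℂ)) := by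
    rw [hT]
    refine tendsto_integral_filter_of_dominated_convergence
      (fun y => ‖kernel σ α y * Ψ (s - y)‖) ?_ ?_ hconv.norm ?_
    · refine Eventually.of_forall fun ε => ?_
      have := measurable_kernel σ α
      have := hs.continuous.measurable
      exact (by fun_prop : Measurable fun y => ((kernel σ α y * Real.exp (-ε * |y|) : ℝ) : ℂ)
        * (Ψ (s - y) : ℂ)).aestronglyMeasurable
    · filter_upwards [self_mem_nhdsWithin] with ε hε
      refine Eventually.of_forall fun y => ?_
      rw [← Complex.ofReal_mul, Complex.norm_real, norm_mul, norm_mul, norm_mul]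
      have : ‖Real.exp (-ε * |y|)‖ ≤ 1 := by
        rw [Real.norm_of_nonneg (Real.exp_pos _).le, Real.exp_le_one_iff]
        have : 0 ≤ ε * |y| := mul_nonneg (le_of_lt hε) (abs_nonneg y)
        linarith
      have h0 := mul_le_mul_of_nonneg_left this (norm_nonneg (kernel σ α y))
      rw [mul_one] at h0
      exact mul_le_mul_of_nonneg_right h0 (norm_nonneg _)
    · refine Eventually.of_forall fun y => ?_
      have : Continuous fun ε : ℝ => ((kernel σ α y * Real.exp (-ε * |y|) : ℝ) : ℂ)
        * (Ψ (s - y) : ℂ) := by fun_prop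
      have := this.tendsto 0
      simp only [neg_zero, zero_mul, Real.exp_zero, mul_one, ← Complex.ofReal_mul] at this
      simp only [← Complex.ofReal_mul]
      exact this.mono_left nhdsWithin_le_nhds
  have hlim_fourier : Tendsto (fun ε : ℝ => 𝓕⁻ (fun η => S ε η * 𝓕 (fun s => (φ s : ℂ)) η) s) (𝓝[>] 0)
      (𝓝 (𝓕⁻ (fun η => symbol σ δ η * 𝓕 (fun s => (φ s : ℂ)) η) s)) := by
    simp only [Real.fourierInv_eq']
    refine tendsto_integral_filter_of_dominated_convergence
      (fun η => ‖symbol σ δ η * 𝓕 (fun s => (φ s : ℂ)) η‖) ?_ ?_ hdom.norm ?_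
    · refine Eventually.of_forall fun ε => ?_
      have he : Continuous fun v : ℝ =>
          Complex.exp (((2 * Real.pi * inner ℝ v s : ℝ) : ℂ) * Complex.I) := by
        fun_prop
      exact he.aestronglyMeasurable.smul (hmeasS ε)
    · refine Eventually.of_forall fun ε => Eventually.of_forall fun η => ?_
      rw [norm_smul, Complex.norm_exp_ofReal_mul_I, one_mul]
      exact hle ε η
    · filter_upwards [compl_mem_ae_iff.2 (measure_singleton (0 : ℝ))] with η hη
      exact ((tendsto_regularised_symbol hσ hη).mul_const _).const_smul _
  -- Both sides of `hinv` converge as `ε → 0+` by dominated convergence; the limits must agree.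
  refine tendsto_nhds_unique hlim_conv (hlim_fourier.congr' ?_)
  filter_upwards [self_mem_nhdsWithin] with ε hε
  exact (hinv ε hε).symm

/-! ### Parseval pairings of real functions. -/

theorem memLp_ofReal {f : ℝ → ℝ} (hf : MemLp f 2 volume) :
    MemLp (fun s => (f s : ℂ)) 2 volume := hf.ofReal

/-- The `L²` Fourier transform (in Mathlib's normalisation) of a real square-integrable function. -/
noncomputable def realFourier {f : ℝ → ℝ} (hf : MemLp f 2 volume) : Lp ℂ 2 (volume : Measure ℝ) :=
  𝓕 ((memLp_ofReal hf).toLp (fun s => (f s : ℂ)))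

theorem integral_mul_eq_realFourier {f g : ℝ → ℝ} (hf : MemLp f 2 volume) (hg : MemLp g 2 volume) :
    ((∫ s, f s * g s : ℝ) : ℂ) = ∫ η, conj (realFourier hg η) * realFourier hf η := by
  have e := Lp.inner_fourier_eq ((memLp_ofReal hg).toLp (fun s => (g s : ℂ)))
    ((memLp_ofReal hf).toLp (fun s => (f s : ℂ)))
  rw [L2.inner_def, L2.inner_def] at e
  have e1 : ∫ a, inner ℂ ((memLp_ofReal hg).toLp (fun s => (g s : ℂ)) a)
      ((memLp_ofReal hf).toLp (fun s => (f s : ℂ)) a) = ((∫ s, f s * g s : ℝ) : ℂ) := by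
    refine Eq.trans ?_ (integral_ofReal (𝕜 := ℂ))
    refine integral_congr_ae ?_
    filter_upwards [(memLp_ofReal hg).coeFn_toLp, (memLp_ofReal hf).coeFn_toLp] with x h1 h2
    rw [h1, h2]
    simp
  rw [← e1, ← e]
  refine integral_congr_ae (Eventually.of_forall fun x => ?_)
  simp [realFourier, mul_comm]

theorem integral_mul_of_eq_fourierInv {f T : ℝ → ℝ} (hf : MemLp f 2 volume) {m : ℝ → ℂ}
    (h1 : Integrable m) (h2 : MemLp m 2 volume) (hT : (fun s => (T s : ℂ)) = 𝓕⁻ m) :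
    ((∫ s, f s * T s : ℝ) : ℂ) = ∫ η, conj (m η) * realFourier hf η := by
  have hTc : MemLp (fun s => (T s : ℂ)) 2 volume := by rw [hT]; exact memLp_fourierInv h1 h2
  have hTm : MemLp T 2 volume := hTc.re
  rw [integral_mul_eq_realFourier hf hTm]
  have : realFourier hTm = h2.toLp m := fourier_toLp_fourierInv h1 h2 hT _
  rw [this]
  refine integral_congr_ae ?_
  filter_upwards [h2.coeFn_toLp] with x hx
  rw [hx]

theorem eq_fourierInv_fourier {φ : ℝ → ℝ} (h : ContDiff ℝ ∞ φ) (hc : HasCompactSupport φ) :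
    (fun s => (φ s : ℂ)) = 𝓕⁻ (𝓕 (fun s => (φ s : ℂ))) := by
  funext s
  exact ((ofReal_integrable h hc).fourierInv_fourier_eq
    (memLp_one_iff_integrable.1 (memLp_fourier h hc 1))
    (ofReal_contDiff h).continuous.continuousAt).symm

theorem integral_mul_test {f φ : ℝ → ℝ} (hf : MemLp f 2 volume) (h : ContDiff ℝ ∞ φ)
    (hc : HasCompactSupport φ) :
    ((∫ s, f s * φ s : ℝ) : ℂ) = ∫ η, conj (𝓕 (fun s => (φ s : ℂ)) η) * realFourier hf η :=
  integral_mul_of_eq_fourierInv hf (memLp_one_iff_integrable.1 (memLp_fourier h hc 1))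
    (memLp_fourier h hc 2) (eq_fourierInv_fourier h hc)

/-- The bases for `σ` and `-σ` are conjugate and never negative real, so conjugation commutes with
the principal power. This expresses that the left and right derivatives are adjoint. -/
theorem conj_symbol_neg {σ δ : ℝ} (hδ : 0 < δ) (η : ℝ) : conj (symbol (-σ) δ η) = symbol σ δ η := by
  rcases eq_or_ne (σ * η) 0 with h0 | h0
  · have : (δ : ℂ) ≠ 0 := by exact_mod_cast hδ.ne'
    simp [symbol, h0, Complex.zero_cpow this]
  · have harg : (2 * Real.pi * Complex.I * (-σ * η : ℝ) : ℂ).arg ≠ Real.pi := by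
      intro h
      have := (Complex.arg_eq_pi_iff.1 h).1
      simp at this
    have := Complex.conj_cpow (2 * Real.pi * Complex.I * (-σ * η : ℝ) : ℂ) (δ : ℂ) harg
    rw [symbol, symbol]
    rw [Complex.conj_ofReal] at this
    rw [← this]
    congr 1
    simp only [map_mul, Complex.conj_I, Complex.conj_ofReal, map_ofNat]
    push_cast
    ring

theorem integral_mul_lineRL {f φ : ℝ → ℝ} (hf : MemLp f 2 volume) {σ δ : ℝ}
    (hσ : σ = 1 ∨ σ = -1) (hδ : 0 < δ) (h : ContDiff ℝ ∞ φ) (hc : HasCompactSupport φ) :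
    ((∫ s, f s * lineRL (-σ) δ φ s : ℝ) : ℂ)
      = ∫ η, conj (𝓕 (fun s => (φ s : ℂ)) η) * (symbol σ δ η * realFourier hf η) := by
  have hσ' : -σ = 1 ∨ -σ = -1 := by rcases hσ with rfl | rfl <;> simp
  rw [integral_mul_of_eq_fourierInv hf
    (memLp_one_iff_integrable.1 (memLp_symbol_mul_fourier hσ' hδ h hc 1))
    (memLp_symbol_mul_fourier hσ' hδ h hc 2) (lineRL_eq_fourierInv hσ' hδ h hc)]
  refine integral_congr_ae (Eventually.of_forall fun η => ?_)
  simp only [map_mul, conj_symbol_neg hδ]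
  ring

/-! ### Weak derivatives as multipliers. -/

/-- Normalised bumps shrinking to `0` form an approximate identity. Their transforms serve to cancel
the test function from a frequency-side identity. -/
theorem exists_tests_fourier_tendsto_one : ∃ φ : ℕ → ℝ → ℝ,
    (∀ n, ContDiff ℝ ∞ (φ n) ∧ HasCompactSupport (φ n)) ∧
    ∀ η, Tendsto (fun n => 𝓕 (fun s => (φ n s : ℂ)) η) atTop (𝓝 1) := by
  let b : ℕ → ContDiffBump (0 : ℝ) := fun n =>
    ⟨1 / (2 * ((n : ℝ) + 1)), 1 / ((n : ℝ) + 1), by positivity, by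
      have : (0 : ℝ) ≤ n := n.cast_nonneg
      exact one_div_lt_one_div_of_lt (by positivity) (by linarith)⟩
  refine ⟨fun n => (b n).normed volume, fun n => ⟨(b n).contDiff_normed,
    (b n).hasCompactSupport_normed⟩, fun η => ?_⟩
  have h1 : Tendsto (fun n => (b n).rOut) atTop (𝓝 0) := tendsto_one_div_add_atTop_nhds_zero_nat
  have h2 := ContDiffBump.convolution_tendsto_right_of_continuous (μ := volume) h1
    (g := fun t : ℝ => Complex.exp (((2 * Real.pi * (t * η) : ℝ) : ℂ) * Complex.I)) (by fun_prop) 0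
  simp only [zero_mul, mul_zero, Complex.ofReal_zero, Complex.exp_zero] at h2
  refine h2.congr fun n => ?_
  rw [Real.fourier_eq', convolution]
  refine integral_congr_ae (Eventually.of_forall fun s => ?_)
  simp only [ContinuousLinearMap.lsmul_apply, Complex.real_smul, smul_eq_mul]
  rw [mul_comm]
  congr 2
  simp
  ring

theorem fourier_translate (Φ : ℝ → ℂ) (a η : ℝ) :
    𝓕 (fun s => Φ (s - a)) η = Complex.exp (((-2 * Real.pi * (a * η) : ℝ) : ℂ) * Complex.I) * 𝓕 Φ η := by
  rw [Real.fourier_eq', Real.fourier_eq', ← integral_const_mul,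
    ← integral_add_right_eq_self _ a]
  refine integral_congr_ae (Eventually.of_forall fun s => ?_)
  simp only [add_sub_cancel_right, smul_eq_mul, ← mul_assoc, ← Complex.exp_add]
  congr 2
  simp
  ring

/-- Used with `p = 2`, `q = 1` and with `p = ⊤`, `q = 2`, which supplies the two hypotheses of
`ae_eq_zero_of_fourierInv_eq_zero`. -/
theorem memLp_conj_fourier_mul {f φ : ℝ → ℝ} (hf : MemLp f 2 volume) {σ δ : ℝ}
    (hσ : σ = 1 ∨ σ = -1) (hδ : 0 < δ) (h : ContDiff ℝ ∞ φ) (hc : HasCompactSupport φ)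
    {p q : ENNReal} [p.HolderTriple 2 q] :
    MemLp (fun η => conj (𝓕 (fun s => (φ s : ℂ)) η) * realFourier hf η) q volume ∧
    MemLp (fun η => conj (𝓕 (fun s => (φ s : ℂ)) η) * (symbol σ δ η * realFourier hf η)) q volume := by
  have h1 : MemLp (fun η => conj (𝓕 (fun s => (φ s : ℂ)) η)) p volume := (memLp_fourier h hc p).star
  have h2 : MemLp (fun η => conj (𝓕 (fun s => (φ s : ℂ)) η) * symbol σ δ η) p volume := by
    refine (memLp_symbol_mul_fourier hσ hδ h hc p).mono
      (h1.1.mul (measurable_symbol σ δ).aestronglyMeasurable) (Eventually.of_forall fun η => ?_)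
    simp [mul_comm]
  refine ⟨(Lp.memLp (realFourier hf)).mul h1, ?_⟩
  simp only [← mul_assoc]
  exact (Lp.memLp (realFourier hf)).mul h2

/-- The weak fractional derivative is the Fourier multiplier `(2πiση)^δ`. -/
theorem realFourier_ae_eq_of_weak {f g : ℝ → ℝ} (hf : MemLp f 2 volume) (hg : MemLp g 2 volume)
    {σ δ : ℝ} (hσ : σ = 1 ∨ σ = -1) (hδ : 0 < δ)
    (hw : ∀ φ, ContDiff ℝ ∞ φ → HasCompactSupport φ →
      ∫ s, g s * φ s = ∫ s, f s * lineRL (-σ) δ φ s) :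
    realFourier hg =ᵐ[volume] fun η => symbol σ δ η * realFourier hf η := by
  set H : ℝ → ℂ := fun η => realFourier hg η - symbol σ δ η * realFourier hf η with hH
  have key : ∀ φ : ℝ → ℝ, ContDiff ℝ ∞ φ → HasCompactSupport φ →
      ∀ᵐ η, conj (𝓕 (fun s => (φ s : ℂ)) η) * H η = 0 := by
    intro φ h hc
    have hsub : (fun η => conj (𝓕 (fun s => (φ s : ℂ)) η) * H η)
        = (fun η => conj (𝓕 (fun s => (φ s : ℂ)) η) * realFourier hg η)
          - fun η => conj (𝓕 (fun s => (φ s : ℂ)) η) * (symbol σ δ η * realFourier hf η) := by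
      funext η; simp [hH, mul_sub]
    refine ae_eq_zero_of_fourierInv_eq_zero ?_ ?_ fun a => ?_
    · rw [hsub]
      exact memLp_one_iff_integrable.1 ((memLp_conj_fourier_mul (p := 2) hg hσ hδ h hc).1.sub
        (memLp_conj_fourier_mul (p := 2) hf hσ hδ h hc).2)
    · rw [hsub]
      exact (memLp_conj_fourier_mul (p := ⊤) hg hσ hδ h hc).1.sub
        (memLp_conj_fourier_mul (p := ⊤) hf hσ hδ h hc).2
    -- Translating `φ` by `a` multiplies the conjugate transform by `e^{2πiaη}`, so the weak
    -- identity for the translate is the vanishing of the inverse transform at `a`.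
    · have ha : ContDiff ℝ ∞ (fun s => φ (s - a)) := h.comp (contDiff_id.sub contDiff_const)
      have hac : HasCompactSupport (fun s => φ (s - a)) :=
        hc.comp_homeomorph (Homeomorph.subRight a)
      have e := congrArg Complex.ofReal (hw _ ha hac)
      rw [integral_mul_test hg ha hac, integral_mul_lineRL hf hσ hδ ha hac, ← sub_eq_zero,
        ← integral_sub (memLp_one_iff_integrable.1
          (memLp_conj_fourier_mul (p := 2) hg hσ hδ ha hac).1)
        (memLp_one_iff_integrable.1 (memLp_conj_fourier_mul (p := 2) hf hσ hδ ha hac).2)] at e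
      rw [← e, Real.fourierInv_eq']
      refine integral_congr_ae (Eventually.of_forall fun η => ?_)
      have hexp : conj (Complex.exp (((-2 * Real.pi * (a * η) : ℝ) : ℂ) * Complex.I))
          = Complex.exp (((2 * Real.pi * inner ℝ η a : ℝ) : ℂ) * Complex.I) := by
        rw [← Complex.exp_conj]
        congr 1
        simp only [map_mul, Complex.conj_I, Complex.conj_ofReal, RCLike.inner_apply, conj_trivial]
        push_cast
        ring
      have ht := fourier_translate (fun s => (φ s : ℂ)) a η
      simp only [hH, smul_eq_mul]
      rw [ht, map_mul, hexp]
      ring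
  obtain ⟨φ, hφ, hlim⟩ := exists_tests_fourier_tendsto_one
  have hall : ∀ᵐ η, ∀ n, conj (𝓕 (fun s => (φ n s : ℂ)) η) * H η = 0 :=
    ae_all_iff.2 fun n => key _ (hφ n).1 (hφ n).2
  filter_upwards [hall] with η hη
  have h1 : Tendsto (fun n => conj (𝓕 (fun s => (φ n s : ℂ)) η) * H η) atTop
      (𝓝 (conj (1 : ℂ) * H η)) :=
    ((Complex.continuous_conj.tendsto 1).comp (hlim η)).mul_const _
  simp only [hη] at h1
  have := tendsto_nhds_unique h1 tendsto_const_nhds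
  simpa [hH, sub_eq_zero] using this

/-- If the multiplier maps `f` into `L²`, the weak fractional derivative exists. -/
theorem exists_weak_of_memLp {f : ℝ → ℝ} (hf : MemLp f 2 volume)
    {σ δ : ℝ} (hσ : σ = 1 ∨ σ = -1) (hδ : 0 < δ)
    (hm : MemLp (fun η => symbol σ δ η * realFourier hf η) 2 volume) :
    ∃ g, MemLp g 2 volume ∧ ∀ φ, ContDiff ℝ ∞ φ → HasCompactSupport φ →
      ∫ s, g s * φ s = ∫ s, f s * lineRL (-σ) δ φ s := by
  set G : Lp ℂ 2 (volume : Measure ℝ) := 𝓕⁻ (hm.toLp _) with hG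
  -- Taking the real part avoids proving that `G` is real: its pairings with real test functions
  -- already are.
  refine ⟨fun s => (G s).re, (Lp.memLp G).re, fun φ h hc => ?_⟩
  have hφ : MemLp φ 2 volume := h.continuous.memLp_of_hasCompactSupport hc
  have hφF : (realFourier hφ : ℝ → ℂ) =ᵐ[volume] 𝓕 (fun s => (φ s : ℂ)) := by
    have : realFourier hφ = (memLp_fourier h hc 2).toLp _ :=
      fourier_toLp_fourierInv (memLp_one_iff_integrable.1 (memLp_fourier h hc 1)) _
        (eq_fourierInv_fourier h hc) _
    rw [this]
    exact (memLp_fourier h hc 2).coeFn_toLp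
  have e := Lp.inner_fourier_eq ((memLp_ofReal hφ).toLp (fun s => (φ s : ℂ))) G
  have hGF : 𝓕 G = hm.toLp _ := fourier_fourierInv_eq (hm.toLp _)
  rw [L2.inner_def, L2.inner_def, hGF] at e
  have e1 := integral_mul_lineRL hf hσ hδ h hc
  have e2 : ∫ η, inner ℂ (realFourier hφ η) (hm.toLp _ η)
      = ((∫ s, f s * lineRL (-σ) δ φ s : ℝ) : ℂ) := by
    rw [e1]
    refine integral_congr_ae ?_
    filter_upwards [hφF, hm.coeFn_toLp] with η h1 h2
    rw [h1, h2]
    simp only [RCLike.inner_apply]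
    ring
  have e3 : ∫ s, inner ℂ ((memLp_ofReal hφ).toLp (fun s => (φ s : ℂ)) s) (G s)
      = ((∫ s, f s * lineRL (-σ) δ φ s : ℝ) : ℂ) := e.symm.trans e2
  have e4 : ∫ s, inner ℂ ((memLp_ofReal hφ).toLp (fun s => (φ s : ℂ)) s) (G s)
      = ∫ s, G s * (φ s : ℂ) := by
    refine integral_congr_ae ?_
    filter_upwards [(memLp_ofReal hφ).coeFn_toLp] with s hs
    rw [hs]
    simp
  rw [e4] at e3
  have hint : Integrable (fun s => G s * (φ s : ℂ)) :=
    memLp_one_iff_integrable.1 ((memLp_ofReal hφ).mul (Lp.memLp G))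
  have e5 := congrArg Complex.re e3
  rw [Complex.ofReal_re] at e5
  rw [← e5]
  refine Eq.trans ?_ (integral_re hint)
  refine integral_congr_ae (Eventually.of_forall fun s => ?_)
  simp

/-! ### Change of variables `s = ψ t`. -/

/-- The preimage of a null set under `f` lies in its image under `g`, and differentiable maps of the
line send null sets to null sets. -/
theorem quasiMeasurePreserving_of_inverse {f g : ℝ → ℝ} (hf : Continuous f)
    (hg : Differentiable ℝ g) (hfg : Function.LeftInverse g f) :
    Measure.QuasiMeasurePreserving f volume volume := by
  refine ⟨hf.measurable, Measure.AbsolutelyContinuous.mk fun s hs h0 => ?_⟩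
  rw [Measure.map_apply hf.measurable hs]
  refine measure_mono_null (t := g '' s) (fun x hx => ⟨f x, hx, hfg x⟩) ?_
  exact addHaar_image_eq_zero_of_differentiableOn_of_addHaar_eq_zero volume hg.differentiableOn h0

/-- `g` is the weak derivative of `f` on the unweighted line. -/
def IsLineDeriv (σ δ : ℝ) (f g : ℝ → ℝ) : Prop :=
  MemLp g 2 volume ∧ ∀ φ, ContDiff ℝ ∞ φ → HasCompactSupport φ →
    ∫ s, g s * φ s = ∫ s, f s * lineRL (-σ) δ φ s

namespace IsScaling

variable {ψ : ℝ → ℝ}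

theorem deriv_pos (hψ : IsScaling ψ) (t : ℝ) : 0 < deriv ψ t :=
  lt_of_le_of_ne (hψ.strictMono.monotone.deriv_nonneg) (hψ.deriv_ne_zero t).symm

theorem surjective (hψ : IsScaling ψ) : Function.Surjective ψ :=
  hψ.differentiable.continuous.surjective hψ.tendsto_atTop hψ.tendsto_atBot

theorem invFun_apply (hψ : IsScaling ψ) (t : ℝ) : Function.invFun ψ (ψ t) = t :=
  Function.leftInverse_invFun hψ.strictMono.injective t

theorem apply_invFun (hψ : IsScaling ψ) (s : ℝ) : ψ (Function.invFun ψ s) = s :=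
  Function.rightInverse_invFun hψ.surjective s

theorem pull_apply (hψ : IsScaling ψ) (v : ℝ → ℝ) (t : ℝ) : pull ψ v (ψ t) = v t := by
  rw [pull, hψ.invFun_apply]

theorem pull_comp (hψ : IsScaling ψ) (f : ℝ → ℝ) : pull ψ (f ∘ ψ) = f := by
  funext s
  rw [pull, Function.comp_apply, hψ.apply_invFun]

theorem continuous_invFun (hψ : IsScaling ψ) : Continuous (Function.invFun ψ) := by
  have : Function.invFun ψ = (hψ.strictMono.orderIsoOfSurjective ψ hψ.surjective).symm := by
    funext s
    obtain ⟨t, rfl⟩ := hψ.surjective s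
    rw [hψ.invFun_apply]
    exact ((hψ.strictMono.orderIsoOfSurjective ψ hψ.surjective).symm_apply_apply t).symm
  rw [this]
  exact OrderIso.continuous _

theorem differentiable_invFun (hψ : IsScaling ψ) : Differentiable ℝ (Function.invFun ψ) := fun _ =>
  (HasDerivAt.of_local_left_inverse hψ.continuous_invFun.continuousAt
    (hψ.differentiable _).hasDerivAt (hψ.deriv_ne_zero _)
    (Eventually.of_forall hψ.apply_invFun)).differentiableAt

/-- `ψ'` need not be continuous; the substitution rule for injective differentiable maps suffices
and asks nothing of `f`. -/
theorem integral_comp_mul_deriv (hψ : IsScaling ψ) (f : ℝ → ℝ) :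
    ∫ t, f (ψ t) * deriv ψ t = ∫ s, f s := by
  have := integral_image_eq_integral_abs_deriv_smul MeasurableSet.univ
    (fun x _ => (hψ.differentiable x).hasDerivAt.hasDerivWithinAt)
    hψ.strictMono.injective.injOn f
  rw [image_univ, hψ.surjective.range_eq, Measure.restrict_univ] at this
  rw [this]
  refine integral_congr_ae (Eventually.of_forall fun t => ?_)
  simp [abs_of_pos (hψ.deriv_pos t), mul_comm]

theorem integrable_comp_mul_deriv (hψ : IsScaling ψ) (f : ℝ → ℝ) :
    Integrable (fun t => f (ψ t) * deriv ψ t) ↔ Integrable f := by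
  have := integrableOn_image_iff_integrableOn_abs_deriv_smul MeasurableSet.univ
    (fun x _ => (hψ.differentiable x).hasDerivAt.hasDerivWithinAt)
    hψ.strictMono.injective.injOn f
  rw [image_univ, hψ.surjective.range_eq, integrableOn_univ, integrableOn_univ] at this
  rw [this]
  refine integrable_congr (Eventually.of_forall fun t => ?_)
  simp [abs_of_pos (hψ.deriv_pos t), mul_comm]

theorem aestronglyMeasurable_pull (hψ : IsScaling ψ) (v : ℝ → ℝ) :
    AEStronglyMeasurable (pull ψ v) ↔ AEStronglyMeasurable v := by
  refine ⟨fun h => ?_, fun h => h.comp_quasiMeasurePreserving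
    (quasiMeasurePreserving_of_inverse hψ.continuous_invFun hψ.differentiable hψ.apply_invFun)⟩
  have := h.comp_quasiMeasurePreserving (quasiMeasurePreserving_of_inverse
    hψ.differentiable.continuous hψ.differentiable_invFun hψ.invFun_apply)
  have e : pull ψ v ∘ ψ = v := by
    funext t
    exact hψ.pull_apply v t
  rwa [e] at this

theorem memL2_iff (hψ : IsScaling ψ) (v : ℝ → ℝ) : MemL2 ψ v ↔ MemLp (pull ψ v) 2 volume := by
  have h : Integrable (fun t => |v t| ^ 2 * deriv ψ t) ↔ Integrable (fun s => pull ψ v s ^ 2) := by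
    rw [← hψ.integrable_comp_mul_deriv (fun s => pull ψ v s ^ 2)]
    simp only [hψ.pull_apply, sq_abs]
  rw [MemL2, h, ← hψ.aestronglyMeasurable_pull]
  exact ⟨fun h => (memLp_two_iff_integrable_sq h.1).2 h.2,
    fun h => ⟨h.1, (memLp_two_iff_integrable_sq h.1).1 h⟩⟩

theorem inner2_eq (hψ : IsScaling ψ) (v w : ℝ → ℝ) :
    inner2 ψ v w = ∫ s, pull ψ v s * pull ψ w s := by
  rw [← hψ.integral_comp_mul_deriv]
  simp only [hψ.pull_apply, inner2]

/-- No differentiability of `f` is needed: as `ψ⁻¹` is differentiable, `f ∘ ψ` is differentiable at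
`t` only if `f` is at `ψ t`, and otherwise both derivatives take the default value `0`. -/
theorem scaledDeriv_comp (hψ : IsScaling ψ) (f : ℝ → ℝ) :
    scaledDeriv ψ (f ∘ ψ) = deriv f ∘ ψ := by
  funext t
  have h0 := hψ.deriv_ne_zero t
  rw [scaledDeriv, Function.comp_apply]
  by_cases hd : DifferentiableAt ℝ f (ψ t)
  · rw [deriv_comp t hd (hψ.differentiable t)]
    field_simp
  · rw [deriv_zero_of_not_differentiableAt hd, deriv_zero_of_not_differentiableAt (f := f ∘ ψ),
      mul_zero]
    intro h
    apply hd
    have e : f = (f ∘ ψ) ∘ Function.invFun ψ := by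
      funext s; simp [hψ.apply_invFun]
    rw [e]
    refine DifferentiableAt.comp _ ?_ (hψ.differentiable_invFun _)
    rwa [hψ.invFun_apply]

theorem leftInt_eq (hψ : IsScaling ψ) (α : ℝ) (w : ℝ → ℝ) :
    leftInt ψ α w = (fun s => ∫ y, kernel 1 α y * pull ψ w (s - y)) ∘ ψ := by
  funext t
  simp only [leftInt, Function.comp_apply]
  rw [← integral_sub_left_eq_self _ volume (ψ t), ← hψ.integral_comp_mul_deriv,
    ← integral_indicator measurableSet_Iio, ← integral_const_mul]
  refine integral_congr_ae (Eventually.of_forall fun z => ?_)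
  simp only [sub_sub_cancel, hψ.pull_apply, kernel]
  by_cases hz : z < t
  · have := hψ.strictMono hz
    simp [indicator, hz, this]
    ring
  · have := hψ.strictMono.monotone (not_lt.1 hz)
    simp [indicator, hz, this]

theorem rightInt_eq (hψ : IsScaling ψ) (α : ℝ) (w : ℝ → ℝ) :
    rightInt ψ α w = (fun s => ∫ y, kernel (-1) α y * pull ψ w (s - y)) ∘ ψ := by
  funext t
  simp only [rightInt, Function.comp_apply]
  rw [← integral_sub_left_eq_self _ volume (ψ t), ← hψ.integral_comp_mul_deriv,
    ← integral_indicator measurableSet_Ioi, ← integral_const_mul]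
  refine integral_congr_ae (Eventually.of_forall fun z => ?_)
  simp only [sub_sub_cancel, hψ.pull_apply, kernel]
  by_cases hz : t < z
  · have := hψ.strictMono hz
    simp [indicator, hz, this]
    ring
  · have := hψ.strictMono.monotone (not_lt.1 hz)
    simp [indicator, hz, this]

theorem leftRL_eq (hψ : IsScaling ψ) (δ : ℝ) (w : ℝ → ℝ) :
    leftRL ψ δ w = lineRL 1 δ (pull ψ w) ∘ ψ := by
  have (n : ℕ) (f : ℝ → ℝ) : (scaledDeriv ψ)^[n] (f ∘ ψ) = (signedDeriv 1)^[n] f ∘ ψ := by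
    induction n generalizing f with
    | zero => rfl
    | succ n ih =>
      rw [Function.iterate_succ_apply, Function.iterate_succ_apply, hψ.scaledDeriv_comp, ih]
      congr 2
      funext t
      simp [signedDeriv]
  rw [leftRL, hψ.leftInt_eq, this]
  rfl

theorem rightRL_eq (hψ : IsScaling ψ) (δ : ℝ) (w : ℝ → ℝ) :
    rightRL ψ δ w = lineRL (-1) δ (pull ψ w) ∘ ψ := by
  have (n : ℕ) (f : ℝ → ℝ) : (fun f t => -scaledDeriv ψ f t)^[n] (f ∘ ψ)
      = (signedDeriv (-1))^[n] f ∘ ψ := by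
    induction n generalizing f with
    | zero => rfl
    | succ n ih =>
      rw [Function.iterate_succ_apply, Function.iterate_succ_apply, hψ.scaledDeriv_comp, ← ih]
      congr 1
      funext t
      simp [signedDeriv]
  rw [rightRL, hψ.rightInt_eq, this]
  rfl

theorem isLeftDeriv_iff (hψ : IsScaling ψ) (δ : ℝ) (v g : ℝ → ℝ) :
    IsLeftDeriv ψ δ v g ↔ IsLineDeriv 1 δ (pull ψ v) (pull ψ g) := by
  simp only [IsLeftDeriv, IsLineDeriv, hψ.memL2_iff, hψ.inner2_eq, hψ.rightRL_eq, hψ.pull_comp,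
    IsTest]
  refine and_congr_right fun _ => ⟨fun h φ hs hc => ?_, fun h w hw => h _ hw.1 hw.2⟩
  have := h (φ ∘ ψ)
  rw [hψ.pull_comp] at this
  exact this ⟨hs, hc⟩

theorem isRightDeriv_iff (hψ : IsScaling ψ) (δ : ℝ) (v g : ℝ → ℝ) :
    IsRightDeriv ψ δ v g ↔ IsLineDeriv (-1) δ (pull ψ v) (pull ψ g) := by
  simp only [IsRightDeriv, IsLineDeriv, hψ.memL2_iff, hψ.inner2_eq, hψ.leftRL_eq, hψ.pull_comp,
    IsTest, neg_neg]
  refine and_congr_right fun _ => ⟨fun h φ hs hc => ?_, fun h w hw => h _ hw.1 hw.2⟩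
  have := h (φ ∘ ψ)
  rw [hψ.pull_comp] at this
  exact this ⟨hs, hc⟩

end IsScaling

/-! ### Comparison of the semi-norms -/

theorem memLp_comp_mul {g : ℝ → ℂ} (hg : MemLp g 2 volume) {c : ℝ} (hc : c ≠ 0) :
    MemLp (fun x => g (c * x)) 2 volume := by
  have hq : Measure.QuasiMeasurePreserving (fun x : ℝ => c * x) volume volume :=
    quasiMeasurePreserving_of_inverse (g := fun x => c⁻¹ * x) (by fun_prop) (by fun_prop)
      fun x => by field_simp
  have hm : AEStronglyMeasurable (fun x => g (c * x)) := hg.1.comp_quasiMeasurePreserving hq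
  have hi := (memLp_two_iff_integrable_sq_norm hg.1).1 hg
  exact (memLp_two_iff_integrable_sq_norm hm).2 (hi.comp_mul_left' hc)

theorem fourierL2_ofReal {f : ℝ → ℝ} (hf : MemLp f 2 volume) (ξ : ℝ) :
    fourierL2 (fun s => (f s : ℂ)) ξ = realFourier hf (ξ / (2 * Real.pi)) := by
  rw [fourierL2, dif_pos (memLp_ofReal hf)]
  rfl

/-- After rescaling `ξ = 2πη`, the weight is `1` plus the modulus of the symbol, and the summand `1`
costs nothing because `f ∈ L²`. -/
theorem memLp_weight_iff {f : ℝ → ℝ} (hf : MemLp f 2 volume) {σ δ : ℝ} (hσ : σ = 1 ∨ σ = -1) :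
    MemLp (fun ξ : ℝ => ((1 + |ξ| ^ δ : ℝ) : ℂ) * fourierL2 (fun s => (f s : ℂ)) ξ) 2 volume ↔
      MemLp (fun η => symbol σ δ η * realFourier hf η) 2 volume := by
  have hπ : (2 * Real.pi) ≠ 0 := by positivity
  have hF := Lp.memLp (realFourier hf)
  simp only [fourierL2_ofReal hf]
  constructor
  · intro h
    have h1 := memLp_comp_mul h hπ
    refine h1.mono ((measurable_symbol σ δ).aestronglyMeasurable.mul hF.1)
      (Eventually.of_forall fun η => ?_)
    rw [mul_div_cancel_left₀ _ hπ, norm_mul, norm_mul, norm_symbol hσ, Complex.norm_real,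
      Real.norm_of_nonneg (by positivity), abs_mul, abs_of_pos Real.two_pi_pos]
    gcongr
    linarith
  · intro h
    have h1 : MemLp (fun η : ℝ => ((1 + |2 * Real.pi * η| ^ δ : ℝ) : ℂ) * realFourier hf η) 2
        volume := by
      refine (hF.norm.add h.norm).mono (AEStronglyMeasurable.mul ?_ hF.1)
        (Eventually.of_forall fun η => ?_)
      · exact (by fun_prop : Measurable fun η : ℝ =>
          ((1 + |2 * Real.pi * η| ^ δ : ℝ) : ℂ)).aestronglyMeasurable
      · rw [Pi.add_apply, norm_mul (symbol σ δ η), norm_symbol hσ, norm_mul, Complex.norm_real,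
          Real.norm_of_nonneg (by positivity), Real.norm_of_nonneg (by positivity), abs_mul,
          abs_of_pos Real.two_pi_pos]
        apply le_of_eq; ring
    have h2 := memLp_comp_mul h1 (inv_ne_zero hπ)
    convert h2 using 4 with ξ
    · rw [mul_inv_cancel_left₀ hπ]
    · rw [div_eq_inv_mul]

/-- The square of the semi-norm common to the left and right derivatives. -/
noncomputable def energy {f : ℝ → ℝ} (hf : MemLp f 2 volume) (δ : ℝ) : ℝ :=
  ∫ η, ((2 * Real.pi * |η|) ^ δ * ‖realFourier hf η‖) ^ 2

theorem energy_nonneg {f : ℝ → ℝ} (hf : MemLp f 2 volume) (δ : ℝ) : 0 ≤ energy hf δ :=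
  integral_nonneg fun _ => sq_nonneg _

theorem integral_fourierL2_sq {f : ℝ → ℝ} (hf : MemLp f 2 volume) (δ : ℝ) :
    ∫ ξ : ℝ, (|ξ| ^ δ * ‖fourierL2 (fun s => (f s : ℂ)) ξ‖) ^ 2 = 2 * Real.pi * energy hf δ := by
  have := Measure.integral_comp_div
    (fun η => ((2 * Real.pi * |η|) ^ δ * ‖realFourier hf η‖) ^ 2) (2 * Real.pi)
  rw [abs_of_pos Real.two_pi_pos, smul_eq_mul] at this
  rw [energy, ← this]
  refine integral_congr_ae (Eventually.of_forall fun ξ => ?_)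
  simp only [fourierL2_ofReal hf]
  rw [abs_div, abs_of_pos Real.two_pi_pos, mul_div_cancel₀ _ Real.two_pi_pos.ne']

theorem IsLineDeriv.realFourier_ae_eq {f g : ℝ → ℝ} (hf : MemLp f 2 volume) {σ δ : ℝ}
    (hσ : σ = 1 ∨ σ = -1) (hδ : 0 < δ) (h : IsLineDeriv σ δ f g) :
    realFourier h.1 =ᵐ[volume] fun η => symbol σ δ η * realFourier hf η :=
  realFourier_ae_eq_of_weak hf h.1 hσ hδ h.2

theorem exists_isLineDeriv_iff {f : ℝ → ℝ} (hf : MemLp f 2 volume) {σ δ : ℝ}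
    (hσ : σ = 1 ∨ σ = -1) (hδ : 0 < δ) : (∃ g, IsLineDeriv σ δ f g) ↔
      MemLp (fun ξ : ℝ => ((1 + |ξ| ^ δ : ℝ) : ℂ) * fourierL2 (fun s => (f s : ℂ)) ξ) 2 volume := by
  rw [memLp_weight_iff hf hσ]
  refine ⟨fun ⟨g, hg⟩ => (Lp.memLp _).ae_eq (hg.realFourier_ae_eq hf hσ hδ),
    fun h => exists_weak_of_memLp hf hσ hδ h⟩

theorem IsLineDeriv.integral_sq {f g : ℝ → ℝ} (hf : MemLp f 2 volume) {σ δ : ℝ}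
    (hσ : σ = 1 ∨ σ = -1) (hδ : 0 < δ) (h : IsLineDeriv σ δ f g) :
    ∫ s, g s * g s = energy hf δ := by
  have e := integral_mul_eq_realFourier h.1 h.1
  have e2 : ∫ η, conj (realFourier h.1 η) * realFourier h.1 η = (energy hf δ : ℂ) := by
    refine Eq.trans ?_ (integral_ofReal (𝕜 := ℂ))
    refine integral_congr_ae ?_
    filter_upwards [h.realFourier_ae_eq hf hσ hδ] with η hη
    rw [hη, Complex.conj_mul', norm_mul, norm_symbol hσ]
    simp
  rw [e2] at e
  exact_mod_cast e

/-- The base has argument `±π/2`, so its power `2δ` has phase `±πδ`, and the cosine is even. -/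
theorem re_symbol_sq {δ : ℝ} (hδ : 0 < δ) (η : ℝ) :
    (symbol 1 δ η ^ 2).re = Real.cos (Real.pi * δ) * ((2 * Real.pi * |η|) ^ δ) ^ 2 := by
  rcases eq_or_ne η 0 with rfl | h0
  · have : (δ : ℂ) ≠ 0 := by exact_mod_cast hδ.ne'
    simp [symbol, Complex.zero_cpow this, Real.zero_rpow hδ.ne']
  · rw [← norm_symbol (Or.inl rfl) δ η]
    unfold symbol
    set z : ℂ := 2 * Real.pi * Complex.I * (1 * η : ℝ) with hz
    have hre : z.re = 0 := by simp [hz]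
    have him : z.im = 2 * Real.pi * η := by simp [hz]
    have hz0 : z ≠ 0 := by
      intro h
      rw [h] at him
      have : 2 * Real.pi * η ≠ 0 := by positivity
      exact this him.symm
    have hcos : Real.cos (2 * (z.arg * δ)) = Real.cos (Real.pi * δ) := by
      rcases lt_or_gt_of_ne h0 with h | h
      · rw [Complex.arg_eq_neg_pi_div_two_iff.2 ⟨hre, by
          rw [him]; exact mul_neg_of_pos_of_neg Real.two_pi_pos h⟩, ← Real.cos_neg]
        congr 1; ring
      · rw [Complex.arg_eq_pi_div_two_iff.2 ⟨hre, by
          rw [him]; exact mul_pos Real.two_pi_pos h⟩]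
        congr 1; ring
    have hlog : (Complex.log z * δ).im = z.arg * δ := by simp [Complex.log_im]
    rw [Complex.cpow_def_of_ne_zero hz0, ← Complex.exp_nat_mul, Complex.norm_exp, Complex.exp_re,
      ← Real.exp_nat_mul]
    have h1 : (((2 : ℕ) : ℂ) * (Complex.log z * δ)).re = (2 : ℕ) * (Complex.log z * δ).re := by simp
    have h2 : (((2 : ℕ) : ℂ) * (Complex.log z * δ)).im = 2 * (z.arg * δ) := by
      rw [← hlog]; simp
    rw [h1, h2, hcos, mul_comm]

/-- By `conj_symbol_neg` the two symbols multiply to `symbol 1 δ η ^ 2` instead of a squared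
modulus. The left side is real, so only the real part of the integrand matters. -/
theorem IsLineDeriv.integral_mul {f g h : ℝ → ℝ} (hf : MemLp f 2 volume) {δ : ℝ}
    (hδ : 0 < δ) (hg : IsLineDeriv 1 δ f g) (hh : IsLineDeriv (-1) δ f h) :
    ∫ s, g s * h s = Real.cos (Real.pi * δ) * energy hf δ := by
  have e := congrArg Complex.re (integral_mul_eq_realFourier hg.1 hh.1)
  rw [Complex.ofReal_re] at e
  have hint : Integrable (fun η => conj (realFourier hh.1 η) * realFourier hg.1 η) :=
    memLp_one_iff_integrable.1 ((Lp.memLp (realFourier hg.1)).mul (p := 2) (q := 2)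
      (Lp.memLp (realFourier hh.1)).star)
  have e2 : (∫ η, conj (realFourier hh.1 η) * realFourier hg.1 η).re
      = ∫ η, (conj (realFourier hh.1 η) * realFourier hg.1 η).re := (integral_re hint).symm
  rw [e, e2, energy, ← integral_const_mul]
  refine integral_congr_ae ?_
  filter_upwards [hg.realFourier_ae_eq hf (Or.inl rfl) hδ,
    hh.realFourier_ae_eq hf (Or.inr rfl) hδ] with η h1 h2
  rw [h1, h2, map_mul, conj_symbol_neg hδ]
  have : symbol 1 δ η * conj (realFourier hf η) * (symbol 1 δ η * realFourier hf η)
      = symbol 1 δ η ^ 2 * ((‖realFourier hf η‖ ^ 2 : ℝ) : ℂ) := by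
    rw [Complex.ofReal_pow, ← Complex.conj_mul']; ring
  rw [this, Complex.re_mul_ofReal, re_symbol_sq hδ]
  ring

/-! ### Elementary facts for the constants. -/

theorem cos_pi_mul_ne_zero {δ : ℝ} (hδ : 0 < δ) (hδn : ∀ n : ℕ, δ ≠ (n : ℝ) - 1 / 2) :
    Real.cos (Real.pi * δ) ≠ 0 := by
  intro h
  obtain ⟨k, hk⟩ := Real.cos_eq_zero_iff.1 h
  have hk' : δ = k + 1 / 2 := by
    have : Real.pi * δ = Real.pi * (k + 1 / 2) := by rw [hk]; ring
    exact mul_left_cancel₀ Real.pi_ne_zero this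
  have hk0 : (-1 : ℝ) < k := by linarith
  have hk1 : 0 ≤ k := by
    have : (-1 : ℤ) < k := by exact_mod_cast hk0
    omega
  obtain ⟨m, rfl⟩ := Int.eq_ofNat_of_zero_le hk1
  apply hδn (m + 1)
  rw [hk']; push_cast; ring

/-- Semi-norm bounds pass to norms with the same constants because `c ≤ 1`, which handles the common
`L²` term. -/
theorem sqrt_add_sq_bounds {c n a b : ℝ} (hc0 : 0 ≤ c) (hc1 : c ≤ 1) (ha : 0 ≤ a) (hb : 0 ≤ b)
    (h1 : c * a ≤ b) (h2 : b ≤ 1 * a) :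
    c * Real.sqrt (n ^ 2 + a ^ 2) ≤ Real.sqrt (n ^ 2 + b ^ 2) ∧
      Real.sqrt (n ^ 2 + b ^ 2) ≤ 1 * Real.sqrt (n ^ 2 + a ^ 2) := by
  rw [one_mul] at h2 ⊢
  refine ⟨?_, Real.sqrt_le_sqrt (by gcongr)⟩
  rw [← Real.sqrt_sq hc0, ← Real.sqrt_mul (sq_nonneg c)]
  refine Real.sqrt_le_sqrt ?_
  have e1 : c ^ 2 * n ^ 2 ≤ 1 * n ^ 2 := by
    gcongr; exact pow_le_one₀ hc0 hc1
  have e2 : (c * a) ^ 2 ≤ b ^ 2 := by gcongr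
  nlinarith

/-! ### Equality of the four spaces. -/

namespace IsScaling

variable {ψ : ℝ → ℝ}

theorem exists_isLeftDeriv_iff (hψ : IsScaling ψ) (δ : ℝ) (v : ℝ → ℝ) :
    (∃ g, IsLeftDeriv ψ δ v g) ↔ ∃ g, IsLineDeriv 1 δ (pull ψ v) g := by
  refine ⟨fun ⟨g, hg⟩ => ⟨_, (hψ.isLeftDeriv_iff δ v g).1 hg⟩, fun ⟨g, hg⟩ => ⟨g ∘ ψ, ?_⟩⟩
  rw [hψ.isLeftDeriv_iff, hψ.pull_comp]
  exact hg

theorem exists_isRightDeriv_iff (hψ : IsScaling ψ) (δ : ℝ) (v : ℝ → ℝ) :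
    (∃ g, IsRightDeriv ψ δ v g) ↔ ∃ g, IsLineDeriv (-1) δ (pull ψ v) g := by
  refine ⟨fun ⟨g, hg⟩ => ⟨_, (hψ.isRightDeriv_iff δ v g).1 hg⟩, fun ⟨g, hg⟩ => ⟨g ∘ ψ, ?_⟩⟩
  rw [hψ.isRightDeriv_iff, hψ.pull_comp]
  exact hg

theorem leftSpace_eq (hψ : IsScaling ψ) {δ : ℝ} (hδ : 0 < δ) :
    leftSpace ψ δ = fourierSpace ψ δ := by
  ext v
  refine and_congr_right fun hv => ?_
  rw [hψ.exists_isLeftDeriv_iff, exists_isLineDeriv_iff ((hψ.memL2_iff v).1 hv) (Or.inl rfl) hδ]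
  rfl

theorem rightSpace_eq (hψ : IsScaling ψ) {δ : ℝ} (hδ : 0 < δ) :
    rightSpace ψ δ = fourierSpace ψ δ := by
  ext v
  refine and_congr_right fun hv => ?_
  rw [hψ.exists_isRightDeriv_iff, exists_isLineDeriv_iff ((hψ.memL2_iff v).1 hv) (Or.inr rfl) hδ]
  rfl

theorem mixedSpace_eq (hψ : IsScaling ψ) {δ : ℝ} (hδ : 0 < δ) :
    mixedSpace ψ δ = fourierSpace ψ δ := by
  have : mixedSpace ψ δ = leftSpace ψ δ ∩ rightSpace ψ δ := by
    ext v
    exact and_and_left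
  rw [this, hψ.leftSpace_eq hδ, hψ.rightSpace_eq hδ, inter_self]

end IsScaling

end PsiFrac

/-! ### The equivalence with explicit constants. -/

theorem lemma2 (δ : ℝ) (hδ : 0 < δ) (hδn : ∀ n : ℕ, δ ≠ (n : ℝ) - 1 / 2) :
    ∃ c C : ℝ, 0 < c ∧ 0 < C ∧ ∀ ψ : ℝ → ℝ, PsiFrac.IsScaling ψ →
      (PsiFrac.leftSpace ψ δ = PsiFrac.fourierSpace ψ δ ∧
        PsiFrac.rightSpace ψ δ = PsiFrac.fourierSpace ψ δ ∧
        PsiFrac.mixedSpace ψ δ = PsiFrac.fourierSpace ψ δ) ∧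
      ∀ v ∈ PsiFrac.fourierSpace ψ δ,
        (c * PsiFrac.fourierSemi ψ δ v ≤ PsiFrac.leftSemi ψ δ v ∧
          PsiFrac.leftSemi ψ δ v ≤ C * PsiFrac.fourierSemi ψ δ v) ∧
        (c * PsiFrac.fourierSemi ψ δ v ≤ PsiFrac.rightSemi ψ δ v ∧
          PsiFrac.rightSemi ψ δ v ≤ C * PsiFrac.fourierSemi ψ δ v) ∧
        (c * PsiFrac.fourierSemi ψ δ v ≤ PsiFrac.mixedSemi ψ δ v ∧
          PsiFrac.mixedSemi ψ δ v ≤ C * PsiFrac.fourierSemi ψ δ v) ∧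
        (c * PsiFrac.fourierNorm ψ δ v ≤ PsiFrac.leftNorm ψ δ v ∧
          PsiFrac.leftNorm ψ δ v ≤ C * PsiFrac.fourierNorm ψ δ v) ∧
        (c * PsiFrac.fourierNorm ψ δ v ≤ PsiFrac.rightNorm ψ δ v ∧
          PsiFrac.rightNorm ψ δ v ≤ C * PsiFrac.fourierNorm ψ δ v) ∧
        (c * PsiFrac.fourierNorm ψ δ v ≤ PsiFrac.mixedNorm ψ δ v ∧
          PsiFrac.mixedNorm ψ δ v ≤ C * PsiFrac.fourierNorm ψ δ v) := by
  set r : ℝ := Real.sqrt |Real.cos (Real.pi * δ)| with hr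
  set p : ℝ := Real.sqrt (2 * Real.pi) with hp
  have hr0 : 0 < r := Real.sqrt_pos.2 (abs_pos.2 (PsiFrac.cos_pi_mul_ne_zero hδ hδn))
  have hr1 : r ≤ 1 := Real.sqrt_le_one.2 (Real.abs_cos_le_one _)
  have hp1 : 1 ≤ p := Real.one_le_sqrt.2 (by linarith [Real.pi_gt_three])
  have hp0 : 0 < p := by linarith
  have hc1 : r / p ≤ 1 := (div_le_one hp0).2 (hr1.trans hp1)
  -- With `A` the square root of the energy, the left, right, mixed and Fourier semi-norms are `A`,
  -- `A`, `r A` and `p A`. As `r ≤ 1 ≤ p`, the constants `r / p` and `1` serve all of them.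
  refine ⟨r / p, 1, div_pos hr0 hp0, one_pos, fun ψ hψ =>
    ⟨⟨hψ.leftSpace_eq hδ, hψ.rightSpace_eq hδ, hψ.mixedSpace_eq hδ⟩, fun v hv => ?_⟩⟩
  have hf := (hψ.memL2_iff v).1 hv.1
  -- Which derivative is chosen does not matter: the integrals below are determined by the energy of
  -- `v` alone.
  have hL : PsiFrac.IsLeftDeriv ψ δ v (PsiFrac.leftD ψ δ v) := by
    have h : ∃ g, PsiFrac.IsLeftDeriv ψ δ v g := ((hψ.leftSpace_eq hδ).symm ▸ hv).2
    rw [PsiFrac.leftD, dif_pos h]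
    exact h.choose_spec
  have hR : PsiFrac.IsRightDeriv ψ δ v (PsiFrac.rightD ψ δ v) := by
    have h : ∃ g, PsiFrac.IsRightDeriv ψ δ v g := ((hψ.rightSpace_eq hδ).symm ▸ hv).2
    rw [PsiFrac.rightD, dif_pos h]
    exact h.choose_spec
  rw [hψ.isLeftDeriv_iff] at hL
  rw [hψ.isRightDeriv_iff] at hR
  set A : ℝ := Real.sqrt (PsiFrac.energy hf δ) with hA
  have hA0 : 0 ≤ A := Real.sqrt_nonneg _
  have eL : PsiFrac.leftSemi ψ δ v = A := by
    rw [PsiFrac.leftSemi, PsiFrac.norm2, hψ.inner2_eq, hL.integral_sq hf (Or.inl rfl) hδ]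
  have eR : PsiFrac.rightSemi ψ δ v = A := by
    rw [PsiFrac.rightSemi, PsiFrac.norm2, hψ.inner2_eq, hR.integral_sq hf (Or.inr rfl) hδ]
  have eM : PsiFrac.mixedSemi ψ δ v = r * A := by
    rw [PsiFrac.mixedSemi, hψ.inner2_eq, PsiFrac.IsLineDeriv.integral_mul hf hδ hL hR, abs_mul,
      abs_of_nonneg (PsiFrac.energy_nonneg hf δ), Real.sqrt_mul (abs_nonneg _)]
  have eF : PsiFrac.fourierSemi ψ δ v = p * A := by
    rw [hp, hA, ← Real.sqrt_mul Real.two_pi_pos.le, ← PsiFrac.integral_fourierL2_sq hf δ]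
    rfl
  have hF0 : 0 ≤ PsiFrac.fourierSemi ψ δ v := by rw [eF]; positivity
  have hM0 : 0 ≤ PsiFrac.mixedSemi ψ δ v := by rw [eM]; positivity
  have ec : r / p * PsiFrac.fourierSemi ψ δ v = r * A := by rw [eF]; field_simp
  have hrA : r * A ≤ A := mul_le_of_le_one_left hA0 hr1
  have hAp : A ≤ p * A := le_mul_of_one_le_left hA0 hp1
  have bL : r / p * PsiFrac.fourierSemi ψ δ v ≤ PsiFrac.leftSemi ψ δ v ∧
      PsiFrac.leftSemi ψ δ v ≤ 1 * PsiFrac.fourierSemi ψ δ v := by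
    rw [ec, eL, eF, one_mul]
    exact ⟨hrA, hAp⟩
  have bR : r / p * PsiFrac.fourierSemi ψ δ v ≤ PsiFrac.rightSemi ψ δ v ∧
      PsiFrac.rightSemi ψ δ v ≤ 1 * PsiFrac.fourierSemi ψ δ v := by
    rw [ec, eR, eF, one_mul]
    exact ⟨hrA, hAp⟩
  have bM : r / p * PsiFrac.fourierSemi ψ δ v ≤ PsiFrac.mixedSemi ψ δ v ∧
      PsiFrac.mixedSemi ψ δ v ≤ 1 * PsiFrac.fourierSemi ψ δ v := by
    rw [ec, eM, eF, one_mul]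
    exact ⟨le_rfl, hrA.trans hAp⟩
  have hc0 : 0 ≤ r / p := by positivity
  exact ⟨bL, bR, bM,
    PsiFrac.sqrt_add_sq_bounds hc0 hc1 hF0 (by rw [eL]; exact hA0) bL.1 bL.2,
    PsiFrac.sqrt_add_sq_bounds hc0 hc1 hF0 (by rw [eR]; exact hA0) bR.1 bR.2,
    PsiFrac.sqrt_add_sq_bounds hc0 hc1 hF0 hM0 bM.1 bM.2⟩
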